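/- Let $K$ be a perfect field of characteristic $p>3$. For $n\ge 0$ let $O_1(n)$ be the divided powers algebra over $K$, with basis $x^{(i)}$, $0\le i<p^n$, and multiplication $x^{(i)}x^{(j)}=\binom{i+j}{j}x^{(i+j)}$ (zero if $i+j\ge p^n$), let $\partial$ be its derivation with $\partial x^{(0)}=0$, $\partial x^{(j)}=x^{(j-1)}$ for $j\geq 1$, and let the Zassenhaus algebra $W_1(n)=\{u\partial : u\in O_1(n)\}$ be the resulting Lie algebra of derivations of $O_1(n)$, with basis $e_i=x^{(i+1)}\partial$, $-1\le i\le p^n-2$. Let $A$ be a finite-dimensional commutative associative $K$-algebra with unit and let $D$ be a $K$-linear derivation of $A$. Let $\mathfrak L(A,D)$ be the Lie algebra over $K$ with underlying space $W_1(1)\otimes_K A$ and bracket $\{X,Y\}=[X,Y]+\Phi_D(X,Y)$, where $[e\otimes a,f\otimes b]=[e,f]\otimes ab$ and $\Phi_D$ is the bilinear map with $\Phi_D(e_{-1}\otimes a,e_{-1}\otimes b)=e_{p-2}\otimes(aD(b)-bD(a))$ and $\Phi_D(e_i\otimes a,e_j\otimes b)=0$ for $(i,j)\ne(-1,-1)$.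 1. If $\mathfrak L(A,D)\cong W_1(n)$ as Lie algebras over $K$ for some $n\ge 1$, then $\mathfrak L(A,D)$ is simple. 2. Conversely, suppose that every residue field $A/M$ of $A$ ($M$ a maximal ideal) is equal to $K$, which is automatic if $K$ is algebraically closed or if $A\cong K[x_1,\dots,x_m]/(x_1^p,\dots,x_m^p)$. If $\mathfrak L(A,D)$ is simple, then $\mathfrak L(A,D)\cong W_1(n)$ as Lie algebras over $K$ for some $n\ge 1$. In particular, if every residue field of $A$ is equal to $K$, then $\mathfrak L(A,D)$ is simple if and only if it is isomorphic to $W_1(n)$ for some $n\ge1$. -/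

import Mathlib

open scoped TensorProduct

/-! ### The divided powers algebra -/

/-- Formal series `∑ f i x^(i)` in divided powers `x^(i)`, `i : ℕ` (an auxiliary ring). -/
structure DPSeries (K : Type*) where
  coeff : ℕ → K

namespace DPSeries

@[ext] theorem ext {K : Type*} {f g : DPSeries K} (h : ∀ k, f.coeff k = g.coeff k) : f = g := by
  cases f; cases g; congr; exact funext h

variable {K : Type*} [CommRing K]

instance : Zero (DPSeries K) := ⟨⟨fun _ => 0⟩⟩
instance : One (DPSeries K) := ⟨⟨fun k => if k = 0 then 1 else 0⟩⟩
instance : Add (DPSeries K) := ⟨fun f g => ⟨fun k => f.coeff k + g.coeff k⟩⟩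
instance : Neg (DPSeries K) := ⟨fun f => ⟨fun k => -f.coeff k⟩⟩
instance : Mul (DPSeries K) := ⟨fun f g => ⟨fun k =>
  ∑ ij ∈ Finset.HasAntidiagonal.antidiagonal k, (k.choose ij.1 : K) * (f.coeff ij.1 * g.coeff ij.2)⟩⟩

@[simp] theorem coeff_zero (k : ℕ) : (0 : DPSeries K).coeff k = 0 := rfl
theorem coeff_one (k : ℕ) : (1 : DPSeries K).coeff k = if k = 0 then 1 else 0 := rfl
@[simp] theorem coeff_add (f g : DPSeries K) (k : ℕ) :
    (f + g).coeff k = f.coeff k + g.coeff k := rfl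
@[simp] theorem coeff_neg (f : DPSeries K) (k : ℕ) : (-f).coeff k = -f.coeff k := rfl
theorem coeff_mul (f g : DPSeries K) (k : ℕ) : (f * g).coeff k =
    ∑ ij ∈ Finset.HasAntidiagonal.antidiagonal k, (k.choose ij.1 : K) * (f.coeff ij.1 * g.coeff ij.2) := rfl

theorem mul_comm' (f g : DPSeries K) : f * g = g * f := by
  ext k
  rw [coeff_mul, coeff_mul, ← Finset.Nat.sum_antidiagonal_swap]
  refine Finset.sum_congr rfl fun ij h => ?_
  rw [Finset.HasAntidiagonal.mem_antidiagonal] at h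
  have : k.choose ij.2 = k.choose ij.1 := by
    rw [← h]; exact (Nat.choose_symm_add).symm
  simp only [Prod.fst_swap, Prod.snd_swap, this]
  ring

theorem one_mul' (f : DPSeries K) : 1 * f = f := by
  ext k
  rw [coeff_mul, Finset.sum_eq_single (0, k)]
  · simp [coeff_one]
  · rintro ⟨i, j⟩ h hne
    rw [Finset.HasAntidiagonal.mem_antidiagonal] at h
    have hi : i ≠ 0 := by
      rintro rfl
      exact hne (by simpa using h)
    simp [coeff_one, hi]
  · intro h
    exact absurd (Finset.HasAntidiagonal.mem_antidiagonal.2 (Nat.zero_add k)) h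

theorem mul_assoc' (f g h : DPSeries K) : f * g * h = f * (g * h) := by
  ext n
  simp only [coeff_mul, Finset.mul_sum, Finset.sum_mul, Finset.sum_sigma']
  refine Finset.sum_nbij' (fun x => ⟨(x.2.1, x.2.2 + x.1.2), (x.2.2, x.1.2)⟩)
    (fun x => ⟨(x.1.1 + x.2.1, x.2.2), (x.1.1, x.2.1)⟩) ?_ ?_ ?_ ?_ ?_
  · rintro ⟨⟨a, b⟩, ⟨c, d⟩⟩ hx
    simp only [Finset.mem_sigma, Finset.HasAntidiagonal.mem_antidiagonal] at hx
    obtain ⟨rfl, rfl⟩ := hx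
    simp [add_assoc]
  · rintro ⟨⟨a, b⟩, ⟨c, d⟩⟩ hx
    simp only [Finset.mem_sigma, Finset.HasAntidiagonal.mem_antidiagonal] at hx
    obtain ⟨rfl, rfl⟩ := hx
    simp [add_assoc]
  · rintro ⟨⟨a, b⟩, ⟨c, d⟩⟩ hx
    simp only [Finset.mem_sigma, Finset.HasAntidiagonal.mem_antidiagonal] at hx
    obtain ⟨rfl, rfl⟩ := hx
    rfl
  · rintro ⟨⟨a, b⟩, ⟨c, d⟩⟩ hx
    simp only [Finset.mem_sigma, Finset.HasAntidiagonal.mem_antidiagonal] at hx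
    obtain ⟨rfl, rfl⟩ := hx
    rfl
  · rintro ⟨⟨a, b⟩, ⟨c, d⟩⟩ hx
    simp only [Finset.mem_sigma, Finset.HasAntidiagonal.mem_antidiagonal] at hx
    obtain ⟨rfl, rfl⟩ := hx
    have h1 := Nat.choose_mul (n := c + d + b) (k := c + d) (s := c) (Nat.le_add_right _ _)
    have h2 : c + d + b - c = d + b := by omega
    have h3 : c + d - c = d := by omega
    rw [h2, h3] at h1
    have h4 : ((c + d + b).choose (c + d) : K) * ((c + d).choose c : K) =
        ((c + d + b).choose c : K) * ((d + b).choose d : K) := by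
      rw [← Nat.cast_mul, h1, Nat.cast_mul]
    linear_combination (f.coeff c * g.coeff d * h.coeff b) * h4

instance : CommRing (DPSeries K) where
  add_assoc f g h := by ext; simp [add_assoc]
  zero_add f := by ext; simp
  add_zero f := by ext; simp
  add_comm f g := by ext; simp [add_comm]
  neg_add_cancel f := by ext; simp
  nsmul := nsmulRec
  zsmul := zsmulRec
  mul_assoc := mul_assoc'
  one_mul := one_mul'
  mul_one f := by rw [mul_comm', one_mul']
  mul_comm := mul_comm'
  zero_mul f := by ext; simp [coeff_mul]
  mul_zero f := by ext; simp [coeff_mul]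
  left_distrib f g h := by ext; simp [coeff_mul, mul_add, Finset.sum_add_distrib]
  right_distrib f g h := by ext; simp [coeff_mul, mul_add, add_mul, Finset.sum_add_distrib]

end DPSeries

/-- The divided powers algebra `O_1(n)` over `K`: an element `f` is the linear combination
`∑ f i x^(i)`, `0 ≤ i < p ^ n`, of the basis elements `x^(i)`. -/
def DivPow (K : Type*) (p n : ℕ) : Type _ := Fin (p ^ n) → K

namespace DivPow

section Ring

variable {K : Type*} [CommRing K] {p n : ℕ}

instance : AddCommGroup (DivPow K p n) :=
  inferInstanceAs (AddCommGroup (Fin (p ^ n) → K))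

instance : Module K (DivPow K p n) := inferInstanceAs (Module K (Fin (p ^ n) → K))

/-- The coefficient of `x^(i)` (zero if `p ^ n ≤ i`). -/
def coeff (f : DivPow K p n) (i : ℕ) : K := if h : i < p ^ n then f ⟨i, h⟩ else 0

theorem ext {f g : DivPow K p n} (h : ∀ i < p ^ n, f.coeff i = g.coeff i) : f = g := by
  refine funext fun i => ?_
  have := h i i.2
  simpa [coeff] using this

@[simp] theorem coeff_zero (i : ℕ) : (0 : DivPow K p n).coeff i = 0 := by
  unfold coeff; split <;> rfl

@[simp] theorem coeff_add (f g : DivPow K p n) (i : ℕ) :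
    (f + g).coeff i = f.coeff i + g.coeff i := by
  unfold coeff; split
  · rfl
  · simp

@[simp] theorem coeff_neg (f : DivPow K p n) (i : ℕ) :
    (-f).coeff i = -f.coeff i := by
  unfold coeff; split
  · rfl
  · simp

@[simp] theorem coeff_smul (c : K) (f : DivPow K p n) (i : ℕ) :
    (c • f).coeff i = c * f.coeff i := by
  unfold coeff; split
  · rfl
  · simp

theorem coeff_of_le (f : DivPow K p n) {i : ℕ} (h : p ^ n ≤ i) : f.coeff i = 0 := by
  unfold coeff; rw [dif_neg (by omega)]

/-- The basis element `x^(i)` for `i < p ^ n` (and `0` for larger `i`). -/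
def x (i : ℕ) : DivPow K p n := fun k => if (k : ℕ) = i then 1 else 0

theorem coeff_x (i k : ℕ) :
    (x i : DivPow K p n).coeff k = if k = i ∧ k < p ^ n then 1 else 0 := by
  unfold coeff x
  by_cases h : k < p ^ n <;> simp [h]

/-- The bilinear multiplication with `x^(i) x^(j) = (i + j choose j) x^(i + j)`, where the right
hand side is read as zero when `p ^ n ≤ i + j`. -/
instance : Mul (DivPow K p n) := ⟨fun f g k =>
  ∑ ij ∈ Finset.HasAntidiagonal.antidiagonal (k : ℕ), ((k : ℕ).choose ij.1 : K) * (f.coeff ij.1 * g.coeff ij.2)⟩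

instance : One (DivPow K p n) := ⟨x 0⟩

theorem coeff_mul (f g : DivPow K p n) {k : ℕ} (hk : k < p ^ n) : (f * g).coeff k =
    ∑ ij ∈ Finset.HasAntidiagonal.antidiagonal k, (k.choose ij.1 : K) * (f.coeff ij.1 * g.coeff ij.2) := by
  unfold coeff
  rw [dif_pos hk]
  rfl

/-- Truncation of a divided power series. -/
def trunc (f : DPSeries K) : DivPow K p n := fun k => f.coeff k

theorem coeff_trunc (f : DPSeries K) {k : ℕ} (hk : k < p ^ n) :
    (trunc f : DivPow K p n).coeff k = f.coeff k := by
  unfold coeff trunc; rw [dif_pos hk]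

theorem trunc_mul (f g : DPSeries K) :
    (trunc (f * g) : DivPow K p n) = trunc f * trunc g := by
  refine ext fun k hk => ?_
  rw [coeff_trunc _ hk, coeff_mul _ _ hk, DPSeries.coeff_mul]
  refine Finset.sum_congr rfl fun ij h => ?_
  rw [Finset.HasAntidiagonal.mem_antidiagonal] at h
  rw [coeff_trunc _ (by omega), coeff_trunc _ (by omega)]

theorem trunc_coeff (f : DivPow K p n) : trunc ⟨f.coeff⟩ = f :=
  ext fun _ hk => coeff_trunc _ hk

theorem mul_eq_trunc (f g : DivPow K p n) :
    f * g = trunc (⟨f.coeff⟩ * ⟨g.coeff⟩) := by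
  rw [trunc_mul, trunc_coeff, trunc_coeff]

theorem one_eq_trunc : (1 : DivPow K p n) = trunc 1 := rfl

theorem mul_comm' (f g : DivPow K p n) : f * g = g * f := by
  rw [mul_eq_trunc, mul_comm, ← mul_eq_trunc]

theorem one_mul' (f : DivPow K p n) : 1 * f = f := by
  conv_lhs => rw [← trunc_coeff f, one_eq_trunc, ← trunc_mul, one_mul, trunc_coeff]

theorem mul_assoc' (f g h : DivPow K p n) : f * g * h = f * (g * h) := by
  rw [← trunc_coeff f, ← trunc_coeff g, ← trunc_coeff h]
  simp only [← trunc_mul, mul_assoc]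

theorem add_mul' (f g h : DivPow K p n) : (f + g) * h = f * h + g * h := by
  refine ext fun k hk => ?_
  simp [coeff_mul _ _ hk, mul_add, add_mul, Finset.sum_add_distrib]

theorem smul_mul' (c : K) (f g : DivPow K p n) : (c • f) * g = c • (f * g) := by
  refine ext fun k hk => ?_
  simp only [coeff_mul _ _ hk, coeff_smul, Finset.mul_sum]
  exact Finset.sum_congr rfl fun _ _ => by ring

instance : CommRing (DivPow K p n) where
  __ := (inferInstance : AddCommGroup (DivPow K p n))
  mul_assoc := mul_assoc'
  one_mul := one_mul'
  mul_one f := by rw [mul_comm', one_mul']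
  mul_comm := mul_comm'
  zero_mul f := by
    refine ext fun k hk => ?_
    simp [coeff_mul _ _ hk]
  mul_zero f := by
    refine ext fun k hk => ?_
    simp [coeff_mul _ _ hk]
  left_distrib f g h := by rw [mul_comm', add_mul', mul_comm' g, mul_comm' h]
  right_distrib := add_mul'

instance : Algebra K (DivPow K p n) :=
  Algebra.ofModule smul_mul' fun c f g => by rw [mul_comm', smul_mul', mul_comm']

theorem x_mul_x (i j : ℕ) (hi : i < p ^ n) (hj : j < p ^ n) :
    (x i * x j : DivPow K p n) = ((i + j).choose j : K) • x (i + j) := by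
  refine ext fun k hk => ?_
  rw [coeff_mul _ _ hk, coeff_smul, coeff_x]
  by_cases h : k = i + j
  · subst h
    rw [Finset.sum_eq_single (i, j)]
    · simp [coeff_x, hi, hj, hk, Nat.choose_symm_add (a := i) (b := j)]
    · rintro ⟨a, b⟩ h hne
      rw [Finset.HasAntidiagonal.mem_antidiagonal] at h
      have : a ≠ i := by
        rintro rfl
        exact hne (by simp only [Prod.mk.injEq, true_and]; omega)
      simp [coeff_x, this]
    · intro h
      exact absurd (Finset.HasAntidiagonal.mem_antidiagonal.2 (by rfl)) h
  · rw [Finset.sum_eq_zero]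
    · simp [h]
    · rintro ⟨a, b⟩ hab
      rw [Finset.HasAntidiagonal.mem_antidiagonal] at hab
      by_cases h1 : a = i
      · have h2 : b ≠ j := by omega
        simp [coeff_x, h2]
      · simp [coeff_x, h1]

end Ring

section Deriv

variable (K : Type*) [CommRing K] (p n : ℕ)

/-- The linear map `∂` with `∂ x^(j) = x^(j - 1)` for `0 < j` and `∂ x^(0) = 0`. -/
def shift : DivPow K p n →ₗ[K] DivPow K p n where
  toFun f := fun k => f.coeff (k + 1)
  map_add' f g := funext fun k => coeff_add f g (k + 1)
  map_smul' c f := funext fun k => coeff_smul c f (k + 1)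

variable {K p n}

theorem coeff_shift (f : DivPow K p n) (k : ℕ) :
    (shift K p n f).coeff k = f.coeff (k + 1) := by
  by_cases hk : k < p ^ n
  · conv_lhs => unfold coeff
    rw [dif_pos hk]; rfl
  · rw [coeff_of_le _ (by omega), coeff_of_le _ (by omega)]

theorem shift_mul [CharP K p] [Fact p.Prime] (f g : DivPow K p n) :
    shift K p n (f * g) = f * shift K p n g + g * shift K p n f := by
  refine ext fun k hk => ?_
  have key : (f * g).coeff (k + 1) = ∑ ij ∈ Finset.HasAntidiagonal.antidiagonal (k + 1),
      ((k + 1).choose ij.1 : K) * (f.coeff ij.1 * g.coeff ij.2) := by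
    by_cases h : k + 1 < p ^ n
    · exact coeff_mul f g h
    · have hk' : k + 1 = p ^ n := by omega
      rw [coeff_of_le _ (by omega), hk', Finset.sum_eq_zero]
      rintro ⟨i, j⟩ hij
      rw [Finset.HasAntidiagonal.mem_antidiagonal] at hij
      by_cases h1 : p ^ n ≤ i
      · simp [coeff_of_le f h1]
      · by_cases h2 : p ^ n ≤ j
        · simp [coeff_of_le g h2]
        · have hd : p ∣ (p ^ n).choose i :=
            (Fact.out : p.Prime).dvd_choose_pow (by omega) (by omega)
          rw [(CharP.cast_eq_zero_iff K p _).2 hd, zero_mul]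
  rw [coeff_shift, key, Finset.sum_antidiagonal_choose_succ_mul
    (fun i j => f.coeff i * g.coeff j), coeff_add, mul_comm g, coeff_mul _ _ hk,
    coeff_mul _ _ hk]
  simp only [coeff_shift]
  congr 1
  refine Finset.sum_congr rfl fun ij h => ?_
  rw [Finset.HasAntidiagonal.mem_antidiagonal] at h
  have : k.choose ij.2 = k.choose ij.1 := by
    rw [← h]; exact (Nat.choose_symm_add).symm
  rw [this]

variable (K p n)

/-- The derivation `∂` of `O_1(n)`, for `K` of prime characteristic `p`. -/
def del [CharP K p] [Fact p.Prime] : Derivation K (DivPow K p n) (DivPow K p n) :=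
  Derivation.mk' (shift K p n) fun f g => shift_mul f g

variable {K p n}

theorem coeff_del [CharP K p] [Fact p.Prime] (f : DivPow K p n) (k : ℕ) :
    (del K p n f).coeff k = f.coeff (k + 1) := coeff_shift f k

end Deriv

end DivPow

/-! ### The Zassenhaus algebra -/

section Zassenhaus

variable (K : Type*) [Field K] (p : ℕ) [CharP K p] [Fact p.Prime] (n : ℕ)

open DivPow

theorem smul_del_lie (u v : DivPow K p n) :
    ⁅u • del K p n, v • del K p n⁆ = (u * del K p n v - v * del K p n u) • del K p n := by
  ext f
  simp only [Derivation.commutator_apply, Derivation.smul_apply, smul_eq_mul, Derivation.leibniz]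
  ring

/-- The Lie subalgebra of all derivations `u ∂` of `O_1(n)`, `u ∈ O_1(n)`. -/
def zassenhausSubalgebra : LieSubalgebra K (Derivation K (DivPow K p n) (DivPow K p n)) where
  carrier := {δ | ∃ u : DivPow K p n, δ = u • del K p n}
  zero_mem' := ⟨0, by simp⟩
  add_mem' := by
    rintro _ _ ⟨u, rfl⟩ ⟨v, rfl⟩
    exact ⟨u + v, by rw [add_smul]⟩
  smul_mem' := by
    rintro c _ ⟨u, rfl⟩
    exact ⟨c • u, by rw [smul_assoc]⟩
  lie_mem' := by
    rintro _ _ ⟨u, rfl⟩ ⟨v, rfl⟩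
    exact ⟨_, smul_del_lie K p n u v⟩

/-- The Zassenhaus algebra `W_1(n)`: the Lie algebra of all derivations `u ∂` of `O_1(n)`. -/
def Zassenhaus : Type _ := zassenhausSubalgebra K p n

instance : LieRing (Zassenhaus K p n) := inferInstanceAs (LieRing (zassenhausSubalgebra K p n))

instance : LieAlgebra K (Zassenhaus K p n) :=
  inferInstanceAs (LieAlgebra K (zassenhausSubalgebra K p n))

/-- The element `u ∂` of `W_1(n)`. -/
def Zassenhaus.ofCoeff (u : DivPow K p n) : Zassenhaus K p n := ⟨u • del K p n, u, rfl⟩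

/-- The coefficient at `e_{-1} = ∂` of an element of `W_1(n)`, `1 ≤ n`, in the basis
`e_i = x^(i+1) ∂`, `-1 ≤ i ≤ p ^ n - 2`: that of `δ = u ∂` is the constant term of
`u = δ (x^(1))`. -/
def Zassenhaus.coeffNegOne : Zassenhaus K p n →ₗ[K] K where
  toFun δ := (δ.1 (x 1)).coeff 0
  map_add' δ ε := coeff_add (δ.1 (x 1)) (ε.1 (x 1)) _
  map_smul' c δ := coeff_smul c (δ.1 (x 1)) _

/-- The coefficient at `e_0 = x^(1) ∂` of an element of `W_1(1)`. -/
def Zassenhaus.coeffZero : Zassenhaus K p 1 →ₗ[K] K where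
  toFun δ := (δ.1 (x 1)).coeff 1
  map_add' δ ε := coeff_add (δ.1 (x 1)) (ε.1 (x 1)) _
  map_smul' c δ := coeff_smul c (δ.1 (x 1)) _

end Zassenhaus

/-! ### The algebras `𝔏(A, D)` -/

section Kuznetsov

variable {K A : Type*} [Field K] (p : ℕ) [CharP K p] [Fact p.Prime] [CommRing A] [Algebra K A]

/-- The underlying vector space `A ⊗ W_1(1)` of `𝔏(A, D)`. -/
def KuznetsovAlgebra (_D : Derivation K A A) : Type _ := A ⊗[K] Zassenhaus K p 1

namespace KuznetsovAlgebra

variable (K A) in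
/-- The map `A ⊗ W_1(1) → A`, `∑ a_i ⊗ e_i ↦ a_{-1}`. -/
noncomputable def coeffNegOne : A ⊗[K] Zassenhaus K p 1 →ₗ[K] A :=
  (TensorProduct.rid K A).toLinearMap ∘ₗ
    TensorProduct.map LinearMap.id (Zassenhaus.coeffNegOne K p 1)

/-- The cochain `Φ_D`: for `X = ∑ a_i ⊗ e_i` and `Y = ∑ b_i ⊗ e_i` its value is
`(a_{-1} D(b_{-1}) - b_{-1} D(a_{-1})) ⊗ e_{p-2}`, where `e_{p-2} = x^(p-1) ∂`. -/
noncomputable def Phi (D : Derivation K A A) (X Y : A ⊗[K] Zassenhaus K p 1) :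
    A ⊗[K] Zassenhaus K p 1 :=
  (coeffNegOne K A p X * D (coeffNegOne K A p Y) - coeffNegOne K A p Y * D (coeffNegOne K A p X))
    ⊗ₜ[K] Zassenhaus.ofCoeff K p 1 (DivPow.x (p - 1))

open DivPow

variable (K A) in
/-- The map `A ⊗ W_1(1) → A`, `∑ a_i ⊗ e_i ↦ a_0`. -/
noncomputable def coeffZero : A ⊗[K] Zassenhaus K p 1 →ₗ[K] A :=
  (TensorProduct.rid K A).toLinearMap ∘ₗ
    TensorProduct.map LinearMap.id (Zassenhaus.coeffZero K p)

variable {p}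

theorem del_x_one : del K p 1 (x 1) = 1 := by
  refine DivPow.ext fun k hk => ?_
  have h1 : 1 < p ^ 1 := by simpa using (Fact.out : p.Prime).one_lt
  rw [coeff_del, coeff_x]
  change _ = (x 0 : DivPow K p 1).coeff k
  rw [coeff_x]
  by_cases h : k = 0
  · subst h; rw [pow_one] at *; simp [h1, hk]
  · simp [h]

theorem coeffNegOne_tmul (a : A) (u : DivPow K p 1) :
    coeffNegOne K A p (a ⊗ₜ Zassenhaus.ofCoeff K p 1 u) = u.coeff 0 • a := by
  have h : Zassenhaus.coeffNegOne K p 1 (Zassenhaus.ofCoeff K p 1 u) = u.coeff 0 := by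
    change ((u • del K p 1) (x 1)).coeff 0 = u.coeff 0
    rw [Derivation.smul_apply, del_x_one, smul_eq_mul, mul_one]
  rw [coeffNegOne, LinearMap.comp_apply, TensorProduct.map_tmul, h]
  simp

theorem coeffZero_tmul (a : A) (u : DivPow K p 1) :
    coeffZero K A p (a ⊗ₜ Zassenhaus.ofCoeff K p 1 u) = u.coeff 1 • a := by
  have h : Zassenhaus.coeffZero K p (Zassenhaus.ofCoeff K p 1 u) = u.coeff 1 := by
    change ((u • del K p 1) (x 1)).coeff 1 = u.coeff 1
    rw [Derivation.smul_apply, del_x_one, smul_eq_mul, mul_one]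
  rw [coeffZero, LinearMap.comp_apply, TensorProduct.map_tmul, h]
  simp

theorem tmul_induction {motive : A ⊗[K] Zassenhaus K p 1 → Prop} (X : A ⊗[K] Zassenhaus K p 1)
    (zero : motive 0) (tmul : ∀ a u, motive (a ⊗ₜ Zassenhaus.ofCoeff K p 1 u))
    (add : ∀ X Y, motive X → motive Y → motive (X + Y)) : motive X := by
  refine TensorProduct.induction_on X zero ?_ add
  rintro a ⟨_, u, rfl⟩
  exact tmul a u

theorem ofCoeff_lie (u v : DivPow K p 1) :
    ⁅Zassenhaus.ofCoeff K p 1 u, Zassenhaus.ofCoeff K p 1 v⁆ =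
      Zassenhaus.ofCoeff K p 1 (u * del K p 1 v - v * del K p 1 u) :=
  Subtype.ext (smul_del_lie K p 1 u v)

theorem coeff_zero_mul (u v : DivPow K p 1) : (u * v).coeff 0 = u.coeff 0 * v.coeff 0 := by
  rw [coeff_mul _ _ (pow_pos (Fact.out : p.Prime).pos 1)]
  simp

theorem coeff_sub' (u v : DivPow K p 1) (i : ℕ) :
    (u - v).coeff i = u.coeff i - v.coeff i := by
  rw [sub_eq_add_neg, coeff_add, coeff_neg, sub_eq_add_neg]

theorem coeffNegOne_lie (X Y : A ⊗[K] Zassenhaus K p 1) :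
    coeffNegOne K A p ⁅X, Y⁆ = coeffNegOne K A p X * coeffZero K A p Y -
      coeffZero K A p X * coeffNegOne K A p Y := by
  induction X using tmul_induction with
  | zero => simp
  | add X X' h h' => rw [add_lie, map_add, map_add, map_add, h, h']; ring
  | tmul a u =>
    induction Y using tmul_induction with
    | zero => simp
    | add X X' h h' => rw [lie_add, map_add, map_add, map_add, h, h']; ring
    | tmul b v =>
      rw [LieAlgebra.ExtendScalars.bracket_tmul, ofCoeff_lie]
      simp only [coeffNegOne_tmul, coeffZero_tmul, coeff_sub', coeff_zero_mul, coeff_del,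
        Algebra.smul_def, map_sub, map_mul, zero_add]
      ring

theorem mul_x_top (u : DivPow K p 1) : u * x (p - 1) = u.coeff 0 • x (p - 1) := by
  have hp := (Fact.out : p.Prime).two_le
  refine DivPow.ext fun k hk => ?_
  rw [coeff_mul _ _ hk, coeff_smul]
  rw [pow_one] at hk
  by_cases h : k = p - 1
  · rw [Finset.sum_eq_single (0, k)]
    · simp
    · rintro ⟨i, j⟩ hij hne
      rw [Finset.HasAntidiagonal.mem_antidiagonal] at hij
      have : j ≠ p - 1 := by
        rintro rfl
        apply hne
        simp only [Prod.mk.injEq]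
        simp only at hij
        omega
      simp [coeff_x, this]
    · intro h
      exact absurd (Finset.HasAntidiagonal.mem_antidiagonal.2 (Nat.zero_add k)) h
  · rw [Finset.sum_eq_zero]
    · simp [coeff_x, h]
    · rintro ⟨i, j⟩ hij
      rw [Finset.HasAntidiagonal.mem_antidiagonal] at hij
      have : j ≠ p - 1 := by
        rintro rfl
        simp only at hij
        omega
      simp [coeff_x, this]

theorem mul_x_pred (u : DivPow K p 1) :
    u * x (p - 2) = u.coeff 0 • x (p - 2) - u.coeff 1 • x (p - 1) := by
  have hp := (Fact.out : p.Prime).two_le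
  refine DivPow.ext fun k hk => ?_
  rw [coeff_mul _ _ hk, coeff_sub', coeff_smul, coeff_smul]
  rw [pow_one] at hk
  by_cases h : k + 2 < p
  · rw [Finset.sum_eq_zero]
    · have h1 : k ≠ p - 2 := by omega
      have h2 : k ≠ p - 1 := by omega
      simp [coeff_x, h1, h2]
    · rintro ⟨i, j⟩ hij
      rw [Finset.HasAntidiagonal.mem_antidiagonal] at hij
      have : j ≠ p - 2 := by
        rintro rfl
        simp only at hij
        omega
      simp [coeff_x, this]
  · rw [Finset.sum_eq_single (k - (p - 2), p - 2)]
    · obtain h | h : k = p - 2 ∨ k = p - 1 := by omega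
      · have h2 : p - 2 ≠ p - 1 := by omega
        have h3 : p - 2 < p := by omega
        subst h
        simp [coeff_x, h2, h3]
      · have h2 : p - 1 ≠ p - 2 := by omega
        have h1 : p - 1 - (p - 2) = 1 := by omega
        have h3 : p - 2 < p := by omega
        have h4 : p - 1 < p := by omega
        have h5 : ((p - 1 : ℕ) : K) = -1 := by
          rw [Nat.cast_sub (by omega), CharP.cast_eq_zero]; simp
        subst h
        simp [coeff_x, h2, h1, h3, h4, h5]
    · rintro ⟨i, j⟩ hij hne
      rw [Finset.HasAntidiagonal.mem_antidiagonal] at hij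
      have : j ≠ p - 2 := by
        rintro rfl
        apply hne
        simp only [Prod.mk.injEq, and_true]
        simp only at hij
        omega
      simp [coeff_x, this]
    · intro h
      refine absurd (Finset.HasAntidiagonal.mem_antidiagonal.2 ?_) h
      simp only
      omega

theorem del_x_top : del K p 1 (x (p - 1)) = x (p - 2) := by
  have hp := (Fact.out : p.Prime).two_le
  refine DivPow.ext fun k hk => ?_
  rw [coeff_del, coeff_x, coeff_x]
  rw [pow_one] at *
  congr 1
  apply propext
  omega

theorem lie_top (X : A ⊗[K] Zassenhaus K p 1) (b : A) :
    ⁅X, b ⊗ₜ[K] Zassenhaus.ofCoeff K p 1 (x (p - 1))⁆ =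
      (coeffNegOne K A p X * b) ⊗ₜ[K] Zassenhaus.ofCoeff K p 1 (x (p - 2)) -
      (2 * (coeffZero K A p X * b)) ⊗ₜ[K] Zassenhaus.ofCoeff K p 1 (x (p - 1)) := by
  induction X using tmul_induction with
  | zero => simp
  | add X X' h h' =>
    rw [add_lie, map_add, map_add, h, h']
    simp only [add_mul, mul_add, TensorProduct.add_tmul]
    abel
  | tmul a u =>
    have key : Zassenhaus.ofCoeff K p 1 (u * del K p 1 (x (p - 1)) - x (p - 1) * del K p 1 u) =
        u.coeff 0 • Zassenhaus.ofCoeff K p 1 (x (p - 2)) -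
          (2 * u.coeff 1) • Zassenhaus.ofCoeff K p 1 (x (p - 1)) := by
      rw [del_x_top, mul_x_pred, mul_comm (x (p - 1)), mul_x_top, coeff_del]
      refine Subtype.ext ?_
      change (_ - _ - _ : DivPow K p 1) • del K p 1 = u.coeff 0 • (x (p - 2) • del K p 1) -
        (2 * u.coeff 1) • (x (p - 1) • del K p 1)
      simp only [sub_smul, smul_assoc, two_mul, add_smul, zero_add]
      abel
    rw [LieAlgebra.ExtendScalars.bracket_tmul, ofCoeff_lie, key, coeffNegOne_tmul,
      coeffZero_tmul, TensorProduct.tmul_sub, ← TensorProduct.smul_tmul,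
      ← TensorProduct.smul_tmul]
    congr 2
    · simp
    · simp only [Algebra.smul_def, map_mul, map_ofNat]
      ring

theorem coeffNegOne_top (b : A) :
    coeffNegOne K A p (b ⊗ₜ[K] Zassenhaus.ofCoeff K p 1 (x (p - 1))) = 0 := by
  have hp := (Fact.out : p.Prime).two_le
  have h : 0 ≠ p - 1 := by omega
  simp [coeffNegOne_tmul, coeff_x, h]

theorem Phi_top (D : Derivation K A A) (X : A ⊗[K] Zassenhaus K p 1) (b : A) :
    Phi p D X (b ⊗ₜ[K] Zassenhaus.ofCoeff K p 1 (x (p - 1))) = 0 := by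
  simp [Phi, coeffNegOne_top]

theorem Phi_swap (D : Derivation K A A) (X Y : A ⊗[K] Zassenhaus K p 1) :
    Phi p D Y X = -Phi p D X Y := by
  rw [Phi, Phi, ← TensorProduct.neg_tmul, neg_sub]

/-- The bracket `{X, Y} = [X, Y] + Φ_D(X, Y)` of `𝔏(A, D)`. -/
noncomputable def br (D : Derivation K A A) (X Y : A ⊗[K] Zassenhaus K p 1) :
    A ⊗[K] Zassenhaus K p 1 := ⁅X, Y⁆ + Phi p D X Y

theorem br_add (D : Derivation K A A) (X Y Z : A ⊗[K] Zassenhaus K p 1) :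
    br D X (Y + Z) = br D X Y + br D X Z := by
  have : Phi p D X (Y + Z) = Phi p D X Y + Phi p D X Z := by
    simp only [Phi, ← TensorProduct.add_tmul, map_add]
    congr 1; ring
  rw [br, br, br, this, lie_add]; abel

theorem br_swap (D : Derivation K A A) (X Y : A ⊗[K] Zassenhaus K p 1) :
    br D Y X = -br D X Y := by
  rw [br, br, Phi_swap, ← lie_skew, neg_add]

theorem add_br (D : Derivation K A A) (X Y Z : A ⊗[K] Zassenhaus K p 1) :
    br D (X + Y) Z = br D X Z + br D Y Z := by
  rw [br_swap D Z (X + Y), br_add, br_swap D Z X, br_swap D Z Y, neg_add]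

theorem br_self (D : Derivation K A A) (X : A ⊗[K] Zassenhaus K p 1) : br D X X = 0 := by
  rw [br, lie_self, Phi, sub_self, TensorProduct.zero_tmul, add_zero]

theorem br_smul (D : Derivation K A A) (c : K) (X Y : A ⊗[K] Zassenhaus K p 1) :
    br D X (c • Y) = c • br D X Y := by
  have : Phi p D X (c • Y) = c • Phi p D X Y := by
    simp only [Phi, TensorProduct.smul_tmul', map_smul]
    congr 1
    simp only [Derivation.map_smul, mul_smul_comm, smul_mul_assoc, smul_sub]
  rw [br, br, this, lie_smul, smul_add]

theorem br_leibniz (D : Derivation K A A) (X Y Z : A ⊗[K] Zassenhaus K p 1) :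
    br D X (br D Y Z) = br D (br D X Y) Z + br D Y (br D X Z) := by
  have h : ∀ U V W : A ⊗[K] Zassenhaus K p 1,
      br D U (br D V W) = ⁅U, ⁅V, W⁆⁆ + ⁅U, Phi p D V W⁆ + Phi p D U ⁅V, W⁆ := by
    intro U V W
    rw [show br D V W = ⁅V, W⁆ + Phi p D V W from rfl, br_add, br, br,
      show Phi p D U (Phi p D V W) = 0 from Phi_top D U _]
    abel
  rw [br_swap D Z (br D X Y), h, h, h, leibniz_lie X Y Z, ← lie_skew Z ⁅X, Y⁆]
  simp only [Phi, lie_top, coeffNegOne_lie]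
  generalize Zassenhaus.ofCoeff K p 1 (x (p - 1)) = t
  generalize Zassenhaus.ofCoeff K p 1 (x (p - 2)) = s
  generalize ⁅⁅X, Y⁆, Z⁆ = P
  generalize ⁅Y, ⁅X, Z⁆⁆ = Q
  rw [← sub_eq_zero]
  simp only [map_sub, Derivation.leibniz, smul_eq_mul]
  have collect : ∀ a b c a' b' c' a'' b'' c'' : A,
      P + Q + (a ⊗ₜ[K] s - b ⊗ₜ[K] t) + c ⊗ₜ[K] t -
        (-(-P + (a' ⊗ₜ[K] s - b' ⊗ₜ[K] t) + c' ⊗ₜ[K] t) +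
          (Q + (a'' ⊗ₜ[K] s - b'' ⊗ₜ[K] t) + c'' ⊗ₜ[K] t)) =
      (a + a' - a'') ⊗ₜ[K] s + (c - b + (c' - b') - (c'' - b'')) ⊗ₜ[K] t := by
    intros
    simp only [TensorProduct.add_tmul, TensorProduct.sub_tmul]
    abel
  rw [collect]
  convert add_zero (0 : A ⊗[K] Zassenhaus K p 1) using 2
  · convert TensorProduct.zero_tmul A s using 2
    ring
  · convert TensorProduct.zero_tmul A t using 2
    ring

variable (D : Derivation K A A)

noncomputable instance : AddCommGroup (KuznetsovAlgebra p D) :=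
  inferInstanceAs (AddCommGroup (A ⊗[K] Zassenhaus K p 1))

noncomputable instance : Module K (KuznetsovAlgebra p D) :=
  inferInstanceAs (Module K (A ⊗[K] Zassenhaus K p 1))

/-- The Lie ring `𝔏(A, D)`, with bracket `{X, Y} = [X, Y] + Φ_D(X, Y)`. -/
noncomputable instance : LieRing (KuznetsovAlgebra p D) where
  bracket X Y := br D X Y
  add_lie X Y Z := add_br D X Y Z
  lie_add X Y Z := br_add D X Y Z
  lie_self X := br_self D X
  leibniz_lie X Y Z := br_leibniz D X Y Z

noncomputable instance : LieAlgebra K (KuznetsovAlgebra p D) where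
  lie_smul c X Y := br_smul D c X Y

end KuznetsovAlgebra

end Kuznetsov

/-!
The Zassenhaus algebra `W_1(n)` is simple: the operator `ad ∂` lowers a nonzero element of an ideal
to a multiple of `∂`, and `∂` generates everything (`Zassenhaus.isSimple`).

For the converse, let `H = DPSeries K` be the ring of divided power series with its derivation `∂`.
The derivation `d = ∂ + x^(p-1) D` of `A ⊗ O_1(1)` satisfies `d^p = D` on `A`, and `𝔏(A, D)` is the
space `A ⊗ O_1(1)` with the bracket `u d(v) - v d(u)`. Taylor expansion along `d` at a `K`-point of
`A` (which exists by the assumption on the residue fields) is a homomorphism `T` to `H` that turns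
`d` into `∂`, so that `X ↦ T(X) ∂` is a homomorphism from `𝔏(A, D)` to the Lie algebra of
derivations of `H`. It is injective if `𝔏(A, D)` is simple. Its image consists of `v ∂`, `v ∈ V`,
for the subalgebra `V = im T` of `H`, which is finite-dimensional and mapped to itself by `∂`. It
remains to see that such `v ∂` form a Zassenhaus algebra
(`DPSeries.exists_zassenhaus_toDerivation`).

Let `μ` be the minimal polynomial of `∂` on `V`. Its degree is `dim V`, and `V` is the space of all
solutions of `μ(∂) f = 0`. As `V` is closed under products, only exponents that are powers of `p`
occur in `μ`: `V` is the kernel of `P = ∑ γ_i ∂^(p^i)`, `i ≤ n`, with `γ_n = 1`, and `dim V = p^n`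
(`DPSeries.exists_frobenius_equation`). It suffices to find `s ∈ V` with `∂s` invertible whose
divided powers `s^(k)`, `k < p^n`, belong to `V`: then `x^(k) ↦ s^(k)` is an isomorphism from
`O_1(n)` to `V`, under which `∂` becomes `(∂s)⁻¹ ∂`, and `u ∂ ↦ u(s) (∂s)⁻¹ ∂` is the isomorphism of
Lie algebras that is wanted. By Jacobson's formula (`Derivation.iterate_char_of_eq_mul`) the
generating function `e = ∑ s^(k) t^k` satisfies `∂^(p^i) e = w_i e` with
`w_i = t ∂^(p^i) s + ∑ t^(p^j) (s_{p^(i-j)})^(p^j)`, the sum over `1 ≤ j ≤ i`. Hence, if `P s = 0`,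
all `P s^(k)` with `k < p^n` vanish as soon as `∑ γ_i (s_{p^(i-j)})^(p^j) = 0`, the sum over
`j ≤ i ≤ n`, for `1 ≤ j < n` (`DPSeries.sum_smul_iterate_del_dpow_eq_zero`). Over a perfect field
these equations can be solved one after the other with `s_1 = 1`.
-/

/-! ### Iterated derivations -/

/-- The Leibniz rule for the iterates of a derivation. -/
theorem Derivation.iterate_mul {R B : Type*} [CommRing R] [CommRing B] [Algebra R B]
    (D : Derivation R B B) (n : ℕ) (a b : B) :
    D^[n] (a * b) = ∑ ij ∈ Finset.HasAntidiagonal.antidiagonal n,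
      (n.choose ij.1 : B) * (D^[ij.1] a * D^[ij.2] b) := by
  induction n with
  | zero => simp
  | succ n ih =>
    rw [Function.iterate_succ_apply', ih, map_sum,
      Finset.sum_antidiagonal_choose_succ_mul (fun i j => D^[i] a * D^[j] b),
      ← Finset.sum_add_distrib]
    refine Finset.sum_congr rfl fun ij h => ?_
    rw [Finset.HasAntidiagonal.mem_antidiagonal] at h
    have : n.choose ij.2 = n.choose ij.1 := by
      rw [← h]; exact (Nat.choose_symm_add).symm
    simp only [Derivation.leibniz, Derivation.map_natCast, smul_eq_mul, mul_zero, add_zero, this,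
      Function.iterate_succ_apply']
    ring

/-- In characteristic `p` the `p`-th iterate of a derivation is a derivation. -/
def Derivation.powChar {R B : Type*} [CommRing R] [CommRing B] [Algebra R B] (p : ℕ)
    [Fact p.Prime] [CharP B p] (D : Derivation R B B) : Derivation R B B :=
  Derivation.mk' ((D : B →ₗ[R] B) ^ p) fun a b => by
    have hp := (Fact.out : p.Prime)
    simp only [Module.End.pow_apply, Derivation.coeFn_coe, smul_eq_mul]
    -- the inner binomial coefficients are divisible by `p`
    rw [Derivation.iterate_mul, Finset.sum_eq_add_of_mem (0, p) (p, 0) (by simp) (by simp)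
      (by simp [hp.ne_zero])]
    · simp [mul_comm]
    · rintro ⟨i, j⟩ hij ⟨h1, h2⟩
      rw [Finset.HasAntidiagonal.mem_antidiagonal] at hij
      have hi : i ≠ 0 := by rintro rfl; exact h1 (by simpa using hij)
      have hj : i ≠ p := by rintro rfl; exact h2 (by simpa using hij)
      have hd : p ∣ p.choose i := hp.dvd_choose_self hi (by simp only at hij; omega)
      rw [(CharP.cast_eq_zero_iff B p _).2 hd, zero_mul]

theorem Derivation.powChar_apply {R B : Type*} [CommRing R] [CommRing B] [Algebra R B] (p : ℕ)
    [Fact p.Prime] [CharP B p] (D : Derivation R B B) (b : B) : D.powChar p b = D^[p] b := by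
  change ((D : B →ₗ[R] B) ^ p) b = _
  rw [Module.End.pow_apply]; rfl

theorem Derivation.map_pow_char {R B : Type*} [CommRing R] [CommRing B] [Algebra R B] (p : ℕ)
    [CharP B p] (D : Derivation R B B) (b : B) : D (b ^ p) = 0 := by
  rw [Derivation.leibniz_pow, ← Nat.cast_smul_eq_nsmul B, CharP.cast_eq_zero, zero_smul]

/-! ### The ring of divided power series -/

namespace DPSeries

section Algebra

variable {K : Type*} [CommRing K]

instance : Module K (DPSeries K) where
  smul c f := ⟨fun k => c * f.coeff k⟩
  one_smul _ := DPSeries.ext fun _ => one_mul _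
  mul_smul _ _ _ := DPSeries.ext fun _ => mul_assoc _ _ _
  smul_zero _ := DPSeries.ext fun _ => mul_zero _
  smul_add _ _ _ := DPSeries.ext fun _ => mul_add _ _ _
  add_smul _ _ _ := DPSeries.ext fun _ => add_mul _ _ _
  zero_smul _ := DPSeries.ext fun _ => zero_mul _

@[simp] theorem coeff_smul (c : K) (f : DPSeries K) (k : ℕ) : (c • f).coeff k = c * f.coeff k := rfl

@[simp] theorem coeff_sub (f g : DPSeries K) (k : ℕ) :
    (f - g).coeff k = f.coeff k - g.coeff k := by
  rw [sub_eq_add_neg, coeff_add, coeff_neg, sub_eq_add_neg]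

instance : Algebra K (DPSeries K) :=
  Algebra.ofModule
    (fun c f g => DPSeries.ext fun k => by
      simp only [coeff_mul, coeff_smul, Finset.mul_sum]
      exact Finset.sum_congr rfl fun _ _ => by ring)
    (fun c f g => DPSeries.ext fun k => by
      simp only [coeff_mul, coeff_smul, Finset.mul_sum]
      exact Finset.sum_congr rfl fun _ _ => by ring)

theorem coeff_algebraMap (c : K) (k : ℕ) :
    (algebraMap K (DPSeries K) c).coeff k = if k = 0 then c else 0 := by
  rw [Algebra.algebraMap_eq_smul_one, coeff_smul, coeff_one]; simp

/-- The coefficient of `x^(k)` as a linear form. -/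
def coeffₗ (k : ℕ) : DPSeries K →ₗ[K] K where
  toFun f := f.coeff k
  map_add' f g := coeff_add f g k
  map_smul' c f := coeff_smul c f k

@[simp] theorem coeffₗ_apply (k : ℕ) (f : DPSeries K) : coeffₗ k f = f.coeff k := rfl

theorem coeff_sum {ι : Type*} (s : Finset ι) (f : ι → DPSeries K) (k : ℕ) :
    (∑ i ∈ s, f i).coeff k = ∑ i ∈ s, (f i).coeff k :=
  map_sum (coeffₗ k) f s

theorem coeff_zero_mul (f g : DPSeries K) : (f * g).coeff 0 = f.coeff 0 * g.coeff 0 := by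
  simp [coeff_mul]

/-- The constant term of a divided power series, as an algebra homomorphism. -/
def constCoeff : DPSeries K →ₐ[K] K :=
  AlgHom.ofLinearMap (coeffₗ 0) (by simp [coeff_one]) coeff_zero_mul

@[simp] theorem constCoeff_apply (f : DPSeries K) : constCoeff f = f.coeff 0 := rfl

instance [Nontrivial K] : Nontrivial (DPSeries K) :=
  (constCoeff (K := K)).toRingHom.domain_nontrivial

instance (p : ℕ) [CharP K p] [Nontrivial K] : CharP (DPSeries K) p :=
  charP_of_injective_algebraMap (R := K) (fun a b h => by
    have := congrArg (fun f => f.coeff 0) h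
    simpa [coeff_algebraMap] using this) p

/-- The derivation `∂` of the ring of divided power series, `∂ x^(j) = x^(j - 1)`. -/
def del : Derivation K (DPSeries K) (DPSeries K) :=
  Derivation.mk' (
    { toFun f := ⟨fun k => f.coeff (k + 1)⟩
      map_add' f g := rfl
      map_smul' c f := rfl } : DPSeries K →ₗ[K] DPSeries K) fun f g => by
    refine DPSeries.ext fun k => ?_
    change (f * g).coeff (k + 1) = _
    rw [coeff_mul, Finset.sum_antidiagonal_choose_succ_mul
      (fun i j => f.coeff i * g.coeff j), coeff_add, smul_eq_mul, smul_eq_mul, mul_comm g,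
      coeff_mul, coeff_mul]
    congr 1
    refine Finset.sum_congr rfl fun ij h => ?_
    rw [Finset.HasAntidiagonal.mem_antidiagonal] at h
    have : k.choose ij.2 = k.choose ij.1 := by
      rw [← h]; exact (Nat.choose_symm_add).symm
    rw [this]
    rfl

@[simp] theorem coeff_del (f : DPSeries K) (k : ℕ) : (del f).coeff k = f.coeff (k + 1) := rfl

theorem coeff_iterate_del (f : DPSeries K) (i k : ℕ) :
    (del^[i] f).coeff k = f.coeff (k + i) := by
  induction i generalizing k with
  | zero => rfl
  | succ i ih => rw [Function.iterate_succ_apply', coeff_del, ih]; congr 1; omega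

/-- A divided power series is determined by its derivative and its constant term. -/
theorem ext_del {f g : DPSeries K} (h0 : f.coeff 0 = g.coeff 0) (h : del f = del g) : f = g := by
  refine DPSeries.ext fun k => ?_
  cases k with
  | zero => exact h0
  | succ k => rw [← coeff_del, h, coeff_del]

/-- The `p`-th power of a divided power series is constant, as it is killed by `∂`. -/
theorem pow_char (p : ℕ) [CharP K p] [Nontrivial K] (f : DPSeries K) :
    f ^ p = algebraMap K (DPSeries K) (f.coeff 0 ^ p) := by
  refine ext_del ?_ ?_
  · rw [coeff_algebraMap, if_pos rfl, ← constCoeff_apply, map_pow, constCoeff_apply]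
  · rw [Derivation.map_pow_char, Derivation.map_algebraMap]

end Algebra

section DividedPowers

variable {K : Type*} [CommRing K]

/-- The antiderivative without constant term. -/
def antideriv (f : DPSeries K) : DPSeries K := ⟨fun k => if k = 0 then 0 else f.coeff (k - 1)⟩

@[simp] theorem del_antideriv (f : DPSeries K) : del (antideriv f) = f :=
  DPSeries.ext fun k => by simp [antideriv]

@[simp] theorem coeff_zero_antideriv (f : DPSeries K) : (antideriv f).coeff 0 = 0 := rfl

/-- The divided powers `s^(k)` of `s - s(0)`: they start with `s^(0) = 1`, and `s^(k + 1)` is the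
antiderivative of `s^(k) ∂s`. -/
def dpow (s : DPSeries K) : ℕ → DPSeries K
  | 0 => 1
  | k + 1 => antideriv (dpow s k * del s)

@[simp] theorem dpow_zero (s : DPSeries K) : dpow s 0 = 1 := rfl

theorem del_dpow_succ (s : DPSeries K) (k : ℕ) : del (dpow s (k + 1)) = dpow s k * del s :=
  del_antideriv _

theorem coeff_zero_dpow (s : DPSeries K) (k : ℕ) :
    (dpow s k).coeff 0 = if k = 0 then 1 else 0 := by
  cases k <;> simp [dpow, coeff_one]

theorem dpow_mul_dpow (s : DPSeries K) (i j : ℕ) :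
    dpow s i * dpow s j = ((i + j).choose j : K) • dpow s (i + j) := by
  induction h : i + j generalizing i j with
  | zero =>
    obtain ⟨rfl, rfl⟩ : i = 0 ∧ j = 0 := by omega
    simp
  | succ n ih =>
    cases i with
    | zero =>
      obtain rfl : j = n + 1 := by omega
      simp
    | succ i =>
      cases j with
      | zero =>
        obtain rfl : i = n := by omega
        simp
      | succ j =>
        refine ext_del ?_ ?_
        · simp [coeff_zero_mul, coeff_zero_dpow]
        · have h1 := ih (i + 1) j (by omega)
          have h2 := ih i (j + 1) (by omega)
          rw [Derivation.leibniz, Derivation.map_smul, del_dpow_succ, del_dpow_succ, del_dpow_succ,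
            Nat.choose_succ_succ, Nat.cast_add]
          simp only [Algebra.smul_def, map_add] at h1 h2 ⊢
          linear_combination del s * h1 + del s * h2

end DividedPowers

section Taylor

variable {K A : Type*} [CommRing K] [CommRing A] [Algebra K A]

/-- The Taylor expansion `a ↦ ∑ ε(D^k a) x^(k)` of an algebra with a derivation `D` at a
`K`-point `ε`. -/
def taylor (D : Derivation K A A) (ε : A →ₐ[K] K) : A →ₐ[K] DPSeries K :=
  AlgHom.ofLinearMap
    { toFun a := ⟨fun k => ε (D^[k] a)⟩
      map_add' a b := DPSeries.ext fun k => by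
        change ε (D^[k] (a + b)) = ε (D^[k] a) + ε (D^[k] b)
        rw [iterate_map_add, map_add]
      map_smul' c a := DPSeries.ext fun k => by
        have h : D^[k] (c • a) = c • D^[k] a := by
          have := ((D : A →ₗ[K] A) ^ k).map_smul c a
          simpa only [Module.End.pow_apply, Derivation.coeFn_coe] using this
        change ε (D^[k] (c • a)) = c * ε (D^[k] a)
        rw [h, map_smul, smul_eq_mul] }
    (DPSeries.ext fun k => by
      change ε (D^[k] 1) = _
      cases k with
      | zero => simp [coeff_one]
      | succ k => simp [coeff_one, Function.iterate_succ_apply])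
    (fun a b => DPSeries.ext fun k => by
      change ε (D^[k] (a * b)) = _
      rw [Derivation.iterate_mul, map_sum, coeff_mul]
      refine Finset.sum_congr rfl fun ij _ => ?_
      simp)

theorem del_taylor (D : Derivation K A A) (ε : A →ₐ[K] K) (a : A) :
    del (taylor D ε a) = taylor D ε (D a) := rfl

end Taylor

end DPSeries

/-- The binomial coefficient `(i + j choose j)` is divisible by `p` if the addition of `i` and `j`
carries beyond the first `n` digits in base `p`. -/
theorem Nat.Prime.dvd_choose_of_pow_le_add {p n i j : ℕ} (hp : p.Prime) (hi : i < p ^ n)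
    (hj : j < p ^ n) (h : p ^ n ≤ i + j) : p ∣ (i + j).choose j := by
  obtain ⟨r, hr⟩ := Nat.exists_eq_add_of_le h
  rw [hr, Nat.add_choose_eq]
  refine Finset.dvd_sum fun ab hab => ?_
  rw [Finset.HasAntidiagonal.mem_antidiagonal] at hab
  by_cases h0 : ab.1 = 0
  · rw [Nat.choose_eq_zero_of_lt (n := r) (by omega), mul_zero]
    exact dvd_zero p
  · exact Dvd.dvd.mul_right (hp.dvd_choose_pow h0 (by omega)) _

namespace DivPow

variable {K : Type*} [CommRing K] {p n : ℕ}

@[simp] theorem coeff_sum {ι : Type*} (s : Finset ι) (f : ι → DivPow K p n) (k : ℕ) :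
    (∑ i ∈ s, f i).coeff k = ∑ i ∈ s, (f i).coeff k :=
  map_sum ({ toFun f := f.coeff k, map_zero' := coeff_zero k,
             map_add' f g := coeff_add f g k } : DivPow K p n →+ K) f s

theorem eq_sum_x (f : DivPow K p n) :
    f = ∑ i ∈ Finset.range (p ^ n), f.coeff i • (x i : DivPow K p n) := by
  refine ext fun k hk => ?_
  simp [coeff_x, hk]

/-- The algebra homomorphism `x^(i) ↦ e i` out of the divided powers algebra given by elements
`e i` that multiply like divided powers. -/
def lift {B : Type*} [CommRing B] [Algebra K B] [CharP K p] [Fact p.Prime] (e : ℕ → B)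
    (h0 : e 0 = 1) (h : ∀ i j, e i * e j = ((i + j).choose j : K) • e (i + j)) :
    DivPow K p n →ₐ[K] B :=
  let T : DivPow K p n →ₗ[K] B :=
    { toFun f := ∑ i ∈ Finset.range (p ^ n), f.coeff i • e i
      map_add' f g := by simp only [coeff_add, add_smul, Finset.sum_add_distrib]
      map_smul' c f := by
        simp only [coeff_smul, mul_smul, Finset.smul_sum, RingHom.id_apply] }
  have hT : ∀ i < p ^ n, T (x i) = e i := fun i hi => by
    change ∑ j ∈ Finset.range (p ^ n), (x i : DivPow K p n).coeff j • e j = e i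
    rw [Finset.sum_eq_single i]
    · simp [coeff_x, hi]
    · intro j _ hj
      simp [coeff_x, hj]
    · intro h
      exact absurd (Finset.mem_range.2 hi) h
  AlgHom.ofLinearMap T
    (by rw [show (1 : DivPow K p n) = x 0 from rfl,
      hT 0 (pow_pos (Fact.out : p.Prime).pos n), h0])
    (fun f g => by
      have key : ∀ i < p ^ n, ∀ j < p ^ n, T (x i * x j) = T (x i) * T (x j) := by
        intro i hi j hj
        rw [x_mul_x i j hi hj, hT i hi, hT j hj, h, map_smul]
        by_cases hij : i + j < p ^ n
        · rw [hT _ hij]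
        · rw [(CharP.cast_eq_zero_iff K p _).2
            (Nat.Prime.dvd_choose_of_pow_le_add Fact.out hi hj (not_lt.1 hij)),
            zero_smul, zero_smul]
      conv_lhs => rw [eq_sum_x f, eq_sum_x g]
      conv_rhs => rw [eq_sum_x f, eq_sum_x g]
      simp only [Finset.sum_mul_sum, map_sum]
      refine Finset.sum_congr rfl fun i hi => Finset.sum_congr rfl fun j hj => ?_
      rw [smul_mul_smul_comm, map_smul, map_smul, map_smul, smul_mul_smul_comm,
        key i (Finset.mem_range.1 hi) j (Finset.mem_range.1 hj)])

theorem lift_apply {B : Type*} [CommRing B] [Algebra K B] [CharP K p] [Fact p.Prime] (e : ℕ → B)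
    (h0 : e 0 = 1) (h : ∀ i j, e i * e j = ((i + j).choose j : K) • e (i + j))
    (f : DivPow K p n) :
    lift e h0 h f = ∑ i ∈ Finset.range (p ^ n), f.coeff i • e i := rfl

end DivPow

/-! ### Jacobson's formula for the `p`-th power of a twisted derivation -/

namespace Derivation

variable {R B : Type*} [CommRing R] [CommRing B] [Algebra R B] (δ : Derivation R B B) (w : B)

/-- The coefficient of `T^k` in the polynomial `b_n(T)` such that `δ^n e = b_n(T) e` for every
solution `e` of the differential equation `δ e = T w e`. -/
def bell : ℕ → ℕ → B
  | 0, k => if k = 0 then 1 else 0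
  | n + 1, 0 => δ (bell n 0)
  | n + 1, k + 1 => δ (bell n (k + 1)) + w * bell n k

theorem bell_eq_zero_of_lt {n k : ℕ} (h : n < k) : δ.bell w n k = 0 := by
  induction n generalizing k with
  | zero => simp [bell, h.ne']
  | succ n ih =>
    obtain ⟨k, rfl⟩ := Nat.exists_eq_succ_of_ne_zero (by omega : k ≠ 0)
    rw [bell, ih (by omega), ih (by omega)]; simp

theorem bell_self (n : ℕ) : δ.bell w n n = w ^ n := by
  induction n with
  | zero => simp [bell]
  | succ n ih => rw [bell, ih, bell_eq_zero_of_lt _ _ (Nat.lt_succ_self n), map_zero]; ring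

theorem bell_zero_right {n : ℕ} (hn : n ≠ 0) : δ.bell w n 0 = 0 := by
  induction n with
  | zero => exact absurd rfl hn
  | succ n ih =>
    rw [bell]
    by_cases h : n = 0
    · subst h; simp [bell]
    · rw [ih h, map_zero]

/-- The identity `d/dT b_n = ∑ (n choose i) δ^(i - 1)(w) b_{n - i}`, the sum over `0 < i ≤ n`,
in terms of coefficients. -/
theorem succ_mul_bell (n k : ℕ) :
    ((k + 1 : ℕ) : B) * δ.bell w n (k + 1) =
      ∑ ij ∈ Finset.HasAntidiagonal.antidiagonal n,
        (n.choose ij.1 : B) * ((if ij.1 = 0 then 0 else δ^[ij.1 - 1] w) * δ.bell w ij.2 k) := by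
  induction n generalizing k with
  | zero => simp [bell]
  | succ n ih =>
    rw [Finset.sum_antidiagonal_choose_succ_mul
      (fun i j => (if i = 0 then 0 else δ^[i - 1] w) * δ.bell w j k)]
    have h1 : ∀ j, δ.bell w (j + 1) k =
        δ (δ.bell w j k) + w * (if k = 0 then 0 else δ.bell w j (k - 1)) := by
      intro j
      cases k <;> simp [bell]
    have h2 : ∀ i, (if i + 1 = 0 then 0 else δ^[i + 1 - 1] w) =
        δ (if i = 0 then 0 else δ^[i - 1] w) + if i = 0 then w else 0 := by
      intro i
      cases i <;> simp [Function.iterate_succ_apply']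
    have h3 : (k : B) * δ.bell w n k = ∑ ij ∈ Finset.HasAntidiagonal.antidiagonal n,
        (n.choose ij.1 : B) * ((if ij.1 = 0 then 0 else δ^[ij.1 - 1] w) *
          (if k = 0 then 0 else δ.bell w ij.2 (k - 1))) := by
      cases k with
      | zero => simp
      | succ k => simpa using ih k
    have h4 : δ.bell w n k = ∑ ij ∈ Finset.HasAntidiagonal.antidiagonal n,
        (n.choose ij.1 : B) * ((if ij.1 = 0 then 1 else 0) * δ.bell w ij.2 k) := by
      rw [Finset.sum_eq_single (0, n)]
      · simp
      · rintro ⟨i, j⟩ hij hne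
        rw [Finset.HasAntidiagonal.mem_antidiagonal] at hij
        have : i ≠ 0 := by rintro rfl; exact hne (by simpa using hij)
        simp [this]
      · simp
    have h5 : ((k + 1 : ℕ) : B) * δ.bell w (n + 1) (k + 1) =
        δ (((k + 1 : ℕ) : B) * δ.bell w n (k + 1)) + w * ((k : B) * δ.bell w n k) +
          w * δ.bell w n k := by
      rw [Derivation.leibniz, Derivation.map_natCast, bell]
      push_cast
      simp only [smul_eq_mul]
      ring
    rw [h5, ih k, h3]
    conv_lhs => rw [h4]
    rw [map_sum, Finset.mul_sum, Finset.mul_sum, ← Finset.sum_add_distrib,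
      ← Finset.sum_add_distrib, ← Finset.sum_add_distrib]
    refine Finset.sum_congr rfl fun ij h => ?_
    rw [Finset.HasAntidiagonal.mem_antidiagonal] at h
    have : n.choose ij.2 = n.choose ij.1 := by
      rw [← h]; exact (Nat.choose_symm_add).symm
    rw [h1, h2, this]
    simp only [Derivation.leibniz, Derivation.map_natCast, smul_eq_mul]
    split_ifs <;> ring

theorem iterate_eq_sum_bell_mul {e : B} (he : δ e = w * e) (n : ℕ) :
    δ^[n] e = (∑ k ∈ Finset.range (n + 1), δ.bell w n k) * e := by
  induction n with
  | zero => simp [bell]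
  | succ n ih =>
    rw [Function.iterate_succ_apply', ih, Derivation.leibniz, he, Finset.sum_range_succ' _ (n + 1)]
    simp only [bell, Finset.sum_add_distrib, ← Finset.mul_sum, map_sum, smul_eq_mul]
    have : ∑ k ∈ Finset.range (n + 1), δ (δ.bell w n k) =
        ∑ k ∈ Finset.range (n + 1), δ (δ.bell w n (k + 1)) + δ (δ.bell w n 0) := by
      rw [← Finset.sum_range_succ' (fun k => δ (δ.bell w n k)), Finset.sum_range_succ _ (n + 1),
        bell_eq_zero_of_lt _ _ (Nat.lt_succ_self n), map_zero, add_zero]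
    rw [this]
    ring

/-- Jacobson's formula: in characteristic `p`, a solution of `δ e = w e` satisfies
`δ^p e = (δ^(p - 1) w + w^p) e`. -/
theorem iterate_char_of_eq_mul (p : ℕ) [Fact p.Prime] [CharP B p] {e : B} (he : δ e = w * e) :
    δ^[p] e = (δ^[p - 1] w + w ^ p) * e := by
  have hp := (Fact.out : p.Prime)
  have key : ∀ k, ((k + 1 : ℕ) : B) * δ.bell w p (k + 1) = if k = 0 then δ^[p - 1] w else 0 := by
    intro k
    rw [succ_mul_bell, Finset.sum_eq_single (p, 0)]
    · simp [bell, hp.ne_zero]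
    · rintro ⟨i, j⟩ hij hne
      rw [Finset.HasAntidiagonal.mem_antidiagonal] at hij
      by_cases hi : i = 0
      · simp [hi]
      · have hj : i ≠ p := by rintro rfl; exact hne (by simpa using hij)
        have hd : p ∣ p.choose i := hp.dvd_choose_self hi (by simp only at hij; omega)
        rw [(CharP.cast_eq_zero_iff B p _).2 hd, zero_mul]
    · simp
  rw [iterate_eq_sum_bell_mul δ w he, Finset.sum_eq_add_of_mem 1 p
    (by simp [hp.pos]) (by simp) hp.one_lt.ne, bell_self]
  · have := key 0
    simp only [zero_add, Nat.cast_one, one_mul, if_true] at this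
    rw [this]
  · rintro k hk ⟨h1, h2⟩
    rw [Finset.mem_range] at hk
    cases k with
    | zero => exact bell_zero_right _ _ hp.ne_zero
    | succ k =>
      have h := key k
      rw [if_neg (by omega)] at h
      -- `k + 1 < p` is invertible in characteristic `p`
      have hu : IsUnit ((k + 1 : ℕ) : B) := by
        rw [CharP.isUnit_natCast_iff hp]
        exact Nat.not_dvd_of_pos_of_lt k.succ_pos (by omega)
      exact (hu.mul_right_eq_zero).1 h

/-- The derivation of the power series ring that acts on the coefficients. -/
noncomputable def mapPowerSeries : Derivation R (PowerSeries B) (PowerSeries B) :=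
  Derivation.mk'
    { toFun f := PowerSeries.mk fun k => δ (PowerSeries.coeff k f)
      map_add' f g := by ext k; simp
      map_smul' c f := by ext k; simp } fun f g => by
    ext k
    simp only [LinearMap.coe_mk, AddHom.coe_mk, PowerSeries.coeff_mk, PowerSeries.coeff_mul,
      map_sum, Derivation.leibniz, smul_eq_mul, map_add, Finset.sum_add_distrib]
    congr 1
    exact Finset.Nat.sum_antidiagonal_swap
      (f := fun ij => PowerSeries.coeff ij.1 g * δ (PowerSeries.coeff ij.2 f))

@[simp] theorem coeff_mapPowerSeries (f : PowerSeries B) (k : ℕ) :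
    PowerSeries.coeff k (δ.mapPowerSeries f) = δ (PowerSeries.coeff k f) :=
  PowerSeries.coeff_mk k fun k => δ (PowerSeries.coeff k f)

theorem coeff_iterate_mapPowerSeries (f : PowerSeries B) (m k : ℕ) :
    PowerSeries.coeff k (δ.mapPowerSeries^[m] f) = δ^[m] (PowerSeries.coeff k f) := by
  induction m with
  | zero => rfl
  | succ m ih => rw [Function.iterate_succ_apply', coeff_mapPowerSeries, ih,
      Function.iterate_succ_apply']

theorem iterate_mapPowerSeries_X_mul_C (b : B) (m : ℕ) :
    δ.mapPowerSeries^[m] (PowerSeries.X * PowerSeries.C b) =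
      PowerSeries.X * PowerSeries.C (δ^[m] b) := by
  ext k
  rw [coeff_iterate_mapPowerSeries]
  cases k with
  | zero => simp [iterate_map_zero]
  | succ k =>
    rw [PowerSeries.coeff_succ_X_mul, PowerSeries.coeff_succ_X_mul, PowerSeries.coeff_C,
      PowerSeries.coeff_C]
    split_ifs
    · rfl
    · exact iterate_map_zero _ _

end Derivation

/-! ### The generating function of divided powers -/

namespace DPSeries

variable {K : Type*} [Field K] (p : ℕ) [Fact p.Prime] [CharP K p]

/-- The generating function `∑ s^(k) t^k`. -/
noncomputable def dexp (s : DPSeries K) : PowerSeries (DPSeries K) := PowerSeries.mk (dpow s)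

/-- The power series `w_i` in `t` with `∂^(p^i) (∑ s^(k) t^k) = w_i ∑ s^(k) t^k`. -/
noncomputable def logDeriv (s : DPSeries K) : ℕ → PowerSeries (DPSeries K)
  | 0 => PowerSeries.X * PowerSeries.C (del s)
  | i + 1 => PowerSeries.X * PowerSeries.C (del^[p ^ (i + 1)] s) + logDeriv s i ^ p

instance : CharP (PowerSeries (DPSeries K)) p :=
  charP_of_injective_ringHom (PowerSeries.C_injective (R := DPSeries K)) p

/-- The derivation `∂^(p^i)` acting on the coefficients of power series. -/
noncomputable def frobDel (i : ℕ) :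
    Derivation K (PowerSeries (DPSeries K)) (PowerSeries (DPSeries K)) :=
  (Derivation.powChar p)^[i] (del (K := K)).mapPowerSeries

theorem frobDel_apply (i : ℕ) (f : PowerSeries (DPSeries K)) :
    frobDel p i f = (del (K := K)).mapPowerSeries^[p ^ i] f := by
  induction i generalizing f with
  | zero => rfl
  | succ i ih =>
    rw [frobDel, Function.iterate_succ_apply', Derivation.powChar_apply, pow_succ,
      Function.iterate_mul]
    congr 1
    exact funext ih

theorem frobDel_dexp (s : DPSeries K) (i : ℕ) :
    frobDel p i (dexp s) = logDeriv p s i * dexp s := by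
  induction i with
  | zero =>
    ext k : 1
    rw [frobDel_apply, pow_zero, Function.iterate_one, Derivation.coeff_mapPowerSeries, logDeriv,
      dexp, PowerSeries.coeff_mk, mul_assoc]
    cases k with
    | zero => simp
    | succ k =>
      rw [PowerSeries.coeff_succ_X_mul, PowerSeries.coeff_C_mul, PowerSeries.coeff_mk,
        del_dpow_succ, mul_comm]
  | succ i ih =>
    have h := Derivation.iterate_char_of_eq_mul _ _ p ih
    rw [← Derivation.powChar_apply] at h
    rw [frobDel, Function.iterate_succ_apply', ← frobDel, h, logDeriv]
    congr 2
    have hp := (Fact.out : p.Prime).two_le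
    -- the first summand of `logDeriv p s i`; the others are killed by derivations
    have h1 : (frobDel p i)^[p - 1] (PowerSeries.X * PowerSeries.C (del^[p ^ i] s)) =
        PowerSeries.X * PowerSeries.C (del^[p ^ (i + 1)] s) := by
      have : (⇑(frobDel (K := K) p i)) = (del (K := K)).mapPowerSeries^[p ^ i] :=
        funext (frobDel_apply p i)
      rw [this, ← Function.iterate_mul, Derivation.iterate_mapPowerSeries_X_mul_C,
        ← Function.iterate_add_apply]
      congr 3
      rw [pow_succ]
      obtain ⟨q, rfl⟩ := Nat.exists_eq_add_of_le' hp
      rw [show q + 2 - 1 = q + 1 by omega]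
      ring
    cases i with
    | zero => rw [← h1]; rfl
    | succ i =>
      obtain ⟨q, hq⟩ : ∃ q, p - 1 = q + 1 := ⟨p - 2, by omega⟩
      rw [logDeriv, iterate_map_add, h1, hq, Function.iterate_succ_apply _ _ (_ ^ p),
        Derivation.map_pow_char, iterate_map_zero, add_zero]

theorem logDeriv_eq (s : DPSeries K) (i : ℕ) :
    logDeriv p s i = PowerSeries.X * PowerSeries.C (del^[p ^ i] s) +
      ∑ j ∈ Finset.range i, PowerSeries.X ^ p ^ (j + 1) *
        PowerSeries.C (algebraMap K (DPSeries K) (s.coeff (p ^ (i - 1 - j)) ^ p ^ (j + 1))) := by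
  induction i with
  | zero => simp [logDeriv]
  | succ i ih =>
    rw [logDeriv, ih, add_pow_char, sum_pow_char, Finset.sum_range_succ']
    congr 1
    rw [add_comm]
    congr 1
    · refine Finset.sum_congr rfl fun j _ => ?_
      rw [mul_pow, ← pow_mul, ← pow_succ, ← map_pow, ← map_pow, ← pow_mul, ← pow_succ,
        show i + 1 - 1 - (j + 1) = i - 1 - j by omega]
    · rw [mul_pow, ← map_pow, pow_char p, coeff_iterate_del]
      simp

/-- Let `P = ∑ γ_i ∂^(p^i)`, the sum over `i ≤ n`, and let `P s = 0`. If the coefficients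
`s_{p^l}` satisfy the equations `h`, then `P` kills all the divided powers `s^(k)`, `k < p^n`,
since `P` multiplies their generating function by a multiple of `t^(p^n)`. -/
theorem sum_smul_iterate_del_dpow_eq_zero (s : DPSeries K) (n : ℕ) (γ : ℕ → K)
    (hs : ∑ i ∈ Finset.range (n + 1), γ i • del^[p ^ i] s = 0)
    (h : ∀ j, j + 1 < n →
      ∑ i ∈ Finset.Ioc j n, γ i * s.coeff (p ^ (i - 1 - j)) ^ p ^ (j + 1) = 0)
    {k : ℕ} (hk : k < p ^ n) :
    ∑ i ∈ Finset.range (n + 1), γ i • del^[p ^ i] (dpow s k) = 0 := by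
  have hsum : ∃ c : PowerSeries (DPSeries K),
      ∑ i ∈ Finset.range (n + 1), γ i • logDeriv p s i = PowerSeries.X ^ p ^ n * c := by
    simp only [logDeriv_eq, smul_add, Finset.sum_add_distrib, Finset.smul_sum]
    have h1 : ∑ i ∈ Finset.range (n + 1),
        γ i • (PowerSeries.X * PowerSeries.C (del^[p ^ i] s)) = 0 := by
      have : ∀ i, γ i • (PowerSeries.X * PowerSeries.C (del^[p ^ i] s)) =
          PowerSeries.X * PowerSeries.C (γ i • del^[p ^ i] s) := by
        intro i
        rw [Algebra.smul_def, Algebra.smul_def, PowerSeries.algebraMap_apply, map_mul]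
        ring
      simp only [this]
      rw [← Finset.mul_sum, ← map_sum, hs, map_zero, mul_zero]
    rw [h1, zero_add, Finset.sum_comm' (t' := Finset.range n) (s' := fun j => Finset.Ioc j n)
      (by intro i j; simp only [Finset.mem_range, Finset.mem_Ioc]; omega)]
    have h2 : ∀ j, ∑ i ∈ Finset.Ioc j n, γ i • (PowerSeries.X ^ p ^ (j + 1) *
        PowerSeries.C (algebraMap K (DPSeries K) (s.coeff (p ^ (i - 1 - j)) ^ p ^ (j + 1)))) =
        PowerSeries.X ^ p ^ (j + 1) * PowerSeries.C (algebraMap K (DPSeries K)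
          (∑ i ∈ Finset.Ioc j n, γ i * s.coeff (p ^ (i - 1 - j)) ^ p ^ (j + 1))) := by
      intro j
      rw [map_sum, map_sum, Finset.mul_sum]
      refine Finset.sum_congr rfl fun i _ => ?_
      rw [map_mul, map_mul, Algebra.smul_def, PowerSeries.algebraMap_apply]
      ring
    simp only [h2]
    cases n with
    | zero => exact ⟨0, by simp⟩
    | succ n =>
      rw [Finset.sum_range_succ, Finset.sum_eq_zero, zero_add]
      · exact ⟨_, rfl⟩
      · intro j hj
        rw [h j (by have := Finset.mem_range.1 hj; omega), map_zero, map_zero, mul_zero]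
  obtain ⟨c, hc⟩ := hsum
  have h1 : ∑ i ∈ Finset.range (n + 1), γ i • frobDel p i (dexp s) =
      PowerSeries.X ^ p ^ n * (c * dexp s) := by
    simp only [frobDel_dexp, ← smul_mul_assoc]
    rw [← Finset.sum_mul, hc, mul_assoc]
  have h2 := congrArg (PowerSeries.coeff k) h1
  rw [PowerSeries.coeff_X_pow_mul', if_neg (not_le.2 hk), map_sum] at h2
  rw [← h2]
  refine Finset.sum_congr rfl fun i _ => ?_
  rw [Algebra.smul_def, Algebra.smul_def, PowerSeries.algebraMap_apply, PowerSeries.coeff_C_mul,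
    frobDel_apply, Derivation.coeff_iterate_mapPowerSeries, dexp, PowerSeries.coeff_mk]

end DPSeries

/-! ### Finite-dimensional differential subalgebras of the divided power series -/

namespace DPSeries

open Polynomial

variable {K : Type*} [Field K] (V : Subalgebra K (DPSeries K)) (hV : ∀ f ∈ V, del f ∈ V)

/-- The restriction of `∂` to a subspace that it maps to itself. -/
def delOn : V →ₗ[K] V :=
  ((del : Derivation K (DPSeries K) (DPSeries K)) : DPSeries K →ₗ[K] DPSeries K).restrict
    (p := V.toSubmodule) (q := V.toSubmodule) hV

theorem coe_aeval_delOn (q : K[X]) (f : V) :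
    ((aeval (delOn V hV) q f : V) : DPSeries K) =
      ∑ i ∈ Finset.range (q.natDegree + 1), q.coeff i • del^[i] (f : DPSeries K) := by
  have h : ∀ i, (((delOn V hV ^ i) f : V) : DPSeries K) = del^[i] (f : DPSeries K) := by
    intro i
    induction i with
    | zero => rfl
    | succ i ih =>
      rw [pow_succ', Function.iterate_succ_apply', ← ih]
      rfl
  rw [aeval_eq_sum_range, LinearMap.sum_apply, AddSubmonoidClass.coe_finsetSum]
  refine Finset.sum_congr rfl fun i _ => ?_
  rw [LinearMap.smul_apply, ← h]
  rfl

/-- A series that is killed by a monic differential operator of order `N` with constant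
coefficients and has vanishing coefficients below `N` is zero. -/
theorem eq_zero_of_recurrence {q : K[X]} (hq : q.Monic) {f : DPSeries K}
    (h : ∑ i ∈ Finset.range (q.natDegree + 1), q.coeff i • del^[i] f = 0)
    (h0 : ∀ i < q.natDegree, f.coeff i = 0) : f = 0 := by
  refine DPSeries.ext fun k => ?_
  induction k using Nat.strong_induction_on with
  | _ k ih =>
    by_cases hk : k < q.natDegree
    · exact h0 k hk
    · have := congrArg (fun g => g.coeff (k - q.natDegree)) h
      simp only [coeff_sum, coeff_smul, coeff_iterate_del, coeff_zero] at this
      rw [Finset.sum_range_succ, hq.coeff_natDegree, one_mul,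
        Nat.sub_add_cancel (not_lt.1 hk), Finset.sum_eq_zero, zero_add] at this
      · exact this
      · intro i hi
        rw [ih _ (by have := Finset.mem_range.1 hi; omega), coeff_zero, mul_zero]

theorem minpoly_delOn_apply (f : V) :
    ∑ i ∈ Finset.range ((minpoly K (delOn V hV)).natDegree + 1),
      (minpoly K (delOn V hV)).coeff i • del^[i] (f : DPSeries K) = 0 := by
  rw [← coe_aeval_delOn V hV, minpoly.aeval]; rfl

theorem coeff_zero_minpoly_delOn : (minpoly K (delOn V hV)).coeff 0 = 0 := by
  have h := congrArg (fun g => g.coeff 0) (minpoly_delOn_apply V hV ⟨1, V.one_mem⟩)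
  simp only [coeff_sum, coeff_smul, coeff_iterate_del, coeff_zero, zero_add, coeff_one] at h
  simpa using h

section Finite

variable [FiniteDimensional K V]

theorem monic_minpoly_delOn : (minpoly K (delOn V hV)).Monic :=
  minpoly.monic (Algebra.IsIntegral.isIntegral _)

/-- The first `deg μ` coefficients are coordinates on `V`, where `μ` is the minimal polynomial of
`∂` on `V`: they determine an element of `V` by recursion, and `deg μ ≤ dim V`. -/
theorem bijective_coeff_minpoly : Function.Bijective
    (LinearMap.pi fun i : Fin (minpoly K (delOn V hV)).natDegree =>
      coeffₗ (i : ℕ) ∘ₗ V.toSubmodule.subtype) := by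
  have hinj : Function.Injective
    (LinearMap.pi fun i : Fin (minpoly K (delOn V hV)).natDegree =>
      coeffₗ (i : ℕ) ∘ₗ V.toSubmodule.subtype) := by
    rw [injective_iff_map_eq_zero]
    intro f hf
    refine Subtype.ext ?_
    refine eq_zero_of_recurrence (monic_minpoly_delOn V hV) (minpoly_delOn_apply V hV f) ?_
    intro i hi
    exact congrFun hf ⟨i, hi⟩
  refine ⟨hinj, ?_⟩
  rw [← LinearMap.range_eq_top]
  have h1 := LinearMap.finrank_range_of_inj hinj
  refine Submodule.eq_top_of_finrank_eq (le_antisymm (Submodule.finrank_le _) ?_)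
  rw [h1, Module.finrank_fin_fun]
  have := Polynomial.natDegree_le_of_dvd (LinearMap.minpoly_dvd_charpoly (delOn V hV))
    (LinearMap.charpoly_monic _).ne_zero
  rwa [LinearMap.charpoly_natDegree] at this

/-- The dimension of `V` is the order of the differential equation that defines it. -/
theorem finrank_eq_natDegree_minpoly :
    Module.finrank K V = (minpoly K (delOn V hV)).natDegree :=
  (LinearEquiv.ofBijective _ (bijective_coeff_minpoly V hV)).finrank_eq.trans
    (Module.finrank_fin_fun K)

/-- `V` has a unique element with prescribed coefficients of `x^(i)` for `i` below the dimension
of `V`. -/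
theorem exists_mem_coeff_eq (a : ℕ → K) :
    ∃ f ∈ V, ∀ i < (minpoly K (delOn V hV)).natDegree, f.coeff i = a i := by
  obtain ⟨f, hf⟩ := (bijective_coeff_minpoly V hV).2 fun i => a i
  exact ⟨f, f.2, fun i hi => congrFun hf ⟨i, hi⟩⟩

/-- `V` consists of all solutions of its differential equation. -/
theorem mem_of_recurrence {f : DPSeries K}
    (h : ∑ i ∈ Finset.range ((minpoly K (delOn V hV)).natDegree + 1),
      (minpoly K (delOn V hV)).coeff i • del^[i] f = 0) : f ∈ V := by
  obtain ⟨g, hg, hfg⟩ := exists_mem_coeff_eq V hV f.coeff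
  have : f - g = 0 := by
    refine eq_zero_of_recurrence (monic_minpoly_delOn V hV) ?_ ?_
    · have h2 := minpoly_delOn_apply V hV ⟨g, hg⟩
      simp only [iterate_map_sub, smul_sub, Finset.sum_sub_distrib]
      rw [h, h2, sub_zero]
    · intro i hi
      rw [coeff_sub, hfg i hi, sub_self]
  rwa [sub_eq_zero.1 this]

/-- Since `V` is closed under products, `(j + m choose j) μ_{j + m} = 0` for the coefficients of
the minimal polynomial `μ` of `∂` on `V`: compare coefficients in `μ(∂)(f g) = 0` for the elements
`f` and `g` of `V` that begin with `x^(j)` and `x^(m)`. -/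
theorem choose_mul_coeff_minpoly {j m : ℕ} (hj : j ≠ 0) (hm : m ≠ 0)
    (hjm : j + m ≤ (minpoly K (delOn V hV)).natDegree) :
    ((j + m).choose j : K) * (minpoly K (delOn V hV)).coeff (j + m) = 0 := by
  set μ := minpoly K (delOn V hV) with hμ
  obtain ⟨f, hf, hf'⟩ := exists_mem_coeff_eq V hV fun i => if i = j then 1 else 0
  obtain ⟨g, hg, hg'⟩ := exists_mem_coeff_eq V hV fun i => if i = m then 1 else 0
  rw [← hμ] at hf' hg'
  have hf0 : f.coeff 0 = 0 := by rw [hf' 0 (by omega), if_neg hj.symm]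
  have hg0 : g.coeff 0 = 0 := by rw [hg' 0 (by omega), if_neg hm.symm]
  have h := congrArg (fun g => g.coeff 0) (minpoly_delOn_apply V hV ⟨f * g, V.mul_mem hf hg⟩)
  rw [← hμ] at h
  simp only [coeff_sum, coeff_smul, coeff_iterate_del, coeff_zero, zero_add] at h
  have hmul : ∀ k ≤ μ.natDegree, (f * g).coeff k =
      if k = j + m then ((j + m).choose j : K) else 0 := by
    intro k hk
    rw [coeff_mul]
    have hterm : ∀ ab ∈ Finset.HasAntidiagonal.antidiagonal k,
        (k.choose ab.1 : K) * (f.coeff ab.1 * g.coeff ab.2) =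
          if ab = (j, m) then (k.choose j : K) else 0 := by
      rintro ⟨a, b⟩ hab
      rw [Finset.HasAntidiagonal.mem_antidiagonal] at hab
      simp only at hab
      by_cases ha : a = 0
      · subst ha; simp [hf0, hj.symm]
      by_cases hb : b = 0
      · subst hb; simp [hg0, hm.symm]
      rw [hf' a (by omega), hg' b (by omega)]
      by_cases h1 : a = j <;> by_cases h2 : b = m <;> simp [h1, h2]
    rw [Finset.sum_congr rfl hterm, Finset.sum_ite_eq' ]
    simp only [Finset.HasAntidiagonal.mem_antidiagonal]
    by_cases hk' : k = j + m
    · subst hk'; simp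
    · rw [if_neg hk', if_neg (fun h => hk' h.symm)]
  rw [Finset.sum_congr rfl fun k hk => by
    rw [hmul k (Nat.lt_succ_iff.1 (Finset.mem_range.1 hk))]] at h
  simp only [mul_ite, mul_zero, Finset.sum_ite_eq', Finset.mem_range] at h
  rw [if_pos (by omega)] at h
  rw [mul_comm]; exact h

variable (p : ℕ) [Fact p.Prime] [CharP K p]

/-- The minimal polynomial of `∂` on `V` only involves powers `T^(p^i)`. -/
theorem eq_pow_of_coeff_minpoly_ne_zero {k : ℕ} (hk : (minpoly K (delOn V hV)).coeff k ≠ 0) :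
    ∃ i, k = p ^ i := by
  have hk0 : k ≠ 0 := by
    rintro rfl
    exact hk (coeff_zero_minpoly_delOn V hV)
  have hkN := le_natDegree_of_ne_zero hk
  refine ⟨_, Choose.eq_pow_multiplicity_of_choose_modEq_zero_nat (p := p)
    (Nat.pos_of_ne_zero hk0) fun i hi => ?_⟩
  rw [Finset.mem_Icc] at hi
  obtain ⟨m, rfl⟩ := Nat.exists_eq_add_of_le (show i ≤ k by omega)
  have := choose_mul_coeff_minpoly V hV (j := i) (m := m) (by omega) (by omega) hkN
  rw [Nat.modEq_zero_iff_dvd, ← CharP.cast_eq_zero_iff K p]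
  exact (mul_eq_zero.1 this).resolve_right hk

/-- A finite-dimensional algebra of divided power series that is mapped to itself by `∂` consists
of the solutions of a differential equation `∑ γ_i ∂^(p^i) f = 0`, the sum over `i ≤ n`, with
`γ_n = 1`. In particular its dimension is `p^n`. -/
theorem exists_frobenius_equation (hV : ∀ f ∈ V, del f ∈ V) :
    ∃ (n : ℕ) (γ : ℕ → K), γ n = 1 ∧ Module.finrank K V = p ^ n ∧
      (∀ f, f ∈ V ↔ ∑ i ∈ Finset.range (n + 1), γ i • del^[p ^ i] f = 0) ∧
      ∀ a : ℕ → K, ∃ f ∈ V, ∀ i < p ^ n, f.coeff i = a i := by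
  set μ := minpoly K (delOn V hV) with hμ
  have hmonic : μ.Monic := monic_minpoly_delOn V hV
  obtain ⟨n, hn⟩ := eq_pow_of_coeff_minpoly_ne_zero V hV p (k := μ.natDegree)
    (by rw [← hμ, hmonic.coeff_natDegree]; exact one_ne_zero)
  have hp := (Fact.out : p.Prime)
  have hsum : ∀ f : DPSeries K, ∑ i ∈ Finset.range (μ.natDegree + 1), μ.coeff i • del^[i] f =
      ∑ i ∈ Finset.range (n + 1), μ.coeff (p ^ i) • del^[p ^ i] f := by
    intro f
    symm
    rw [← Finset.sum_image (s := Finset.range (n + 1)) (g := fun i => p ^ i)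
      (f := fun k => μ.coeff k • del^[k] f)
      (fun i _ j _ h => Nat.pow_right_injective hp.two_le h)]
    refine Finset.sum_subset ?_ ?_
    · intro k hk
      obtain ⟨i, hi, rfl⟩ := Finset.mem_image.1 hk
      rw [Finset.mem_range] at hi ⊢
      have := Nat.pow_le_pow_right hp.pos (Nat.lt_succ_iff.1 hi)
      omega
    · intro k hk hk'
      by_contra hne
      have hne' : μ.coeff k ≠ 0 := fun h => hne (by rw [h, zero_smul])
      obtain ⟨i, rfl⟩ := eq_pow_of_coeff_minpoly_ne_zero V hV p hne'
      refine hk' (Finset.mem_image_of_mem _ (Finset.mem_range.2 ?_))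
      rw [Finset.mem_range, hn, Nat.lt_succ_iff] at hk
      exact Nat.lt_succ_iff.2 ((Nat.pow_le_pow_iff_right hp.one_lt).1 hk)
  refine ⟨n, fun i => μ.coeff (p ^ i), ?_, ?_, fun f => ⟨fun hf => ?_, fun hf => ?_⟩, fun a => ?_⟩
  · change μ.coeff (p ^ n) = 1
    rw [← hn]; exact hmonic.coeff_natDegree
  · rw [finrank_eq_natDegree_minpoly V hV, ← hn]
  · rw [← hsum]; exact minpoly_delOn_apply V hV ⟨f, hf⟩
  · rw [← hsum] at hf; exact mem_of_recurrence V hV hf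
  · rw [← hn]; exact exists_mem_coeff_eq V hV a

end Finite

end DPSeries

/-! ### Zassenhaus algebras of derivations -/

theorem DivPow.coeff_iterate_del {K : Type*} [Field K] {p : ℕ} [CharP K p] [Fact p.Prime] {n : ℕ}
    (u : DivPow K p n) (k i : ℕ) : ((DivPow.del K p n)^[k] u).coeff i = u.coeff (i + k) := by
  induction k generalizing i with
  | zero => rfl
  | succ k ih =>
    rw [Function.iterate_succ_apply', DivPow.coeff_del, ih]
    congr 1
    omega

namespace Zassenhaus

variable {K : Type*} [Field K] {p : ℕ} [CharP K p] [Fact p.Prime] {n : ℕ}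

theorem del_x_one (hn : 1 ≤ n) : DivPow.del K p n (DivPow.x 1) = 1 := by
  have hp := (Fact.out : p.Prime)
  have h1 : 1 < p ^ n := Nat.one_lt_pow (by omega) hp.one_lt
  refine DivPow.ext fun k hk => ?_
  rw [DivPow.coeff_del, DivPow.coeff_x]
  change _ = (DivPow.x 0 : DivPow K p n).coeff k
  rw [DivPow.coeff_x]
  by_cases h : k = 0
  · subst h; simp [h1, hk]
  · simp [h]

theorem ofCoeff_lie (u v : DivPow K p n) : ⁅ofCoeff K p n u, ofCoeff K p n v⁆ =
    ofCoeff K p n (u * DivPow.del K p n v - v * DivPow.del K p n u) :=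
  Subtype.ext (smul_del_lie K p n u v)

variable (K p) in
/-- For `1 ≤ n`, the elements `u ∂` of `W_1(n)` correspond to the elements `u = (u ∂) x^(1)` of
`O_1(n)`. -/
def equivDivPow (hn : 1 ≤ n) : Zassenhaus K p n ≃ₗ[K] DivPow K p n where
  toFun δ := δ.1 (DivPow.x 1)
  map_add' _ _ := rfl
  map_smul' _ _ := rfl
  invFun u := ofCoeff K p n u
  left_inv := by
    rintro ⟨_, u, rfl⟩
    refine Subtype.ext ?_
    change ((u • DivPow.del K p n) (DivPow.x 1)) • DivPow.del K p n = u • DivPow.del K p n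
    rw [Derivation.smul_apply, del_x_one hn, smul_eq_mul, mul_one]
  right_inv u := by
    change (u • DivPow.del K p n) (DivPow.x 1) = u
    rw [Derivation.smul_apply, del_x_one hn, smul_eq_mul, mul_one]

@[simp] theorem equivDivPow_ofCoeff (hn : 1 ≤ n) (u : DivPow K p n) :
    equivDivPow K p hn (ofCoeff K p n u) = u :=
  (equivDivPow K p hn).right_inv u

@[simp] theorem equivDivPow_symm (hn : 1 ≤ n) (u : DivPow K p n) :
    (equivDivPow K p hn).symm u = ofCoeff K p n u := rfl

end Zassenhaus

/-- The commutator of two multiples of a derivation. -/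
theorem Derivation.smul_lie_smul_self {R B : Type*} [CommRing R] [CommRing B] [Algebra R B]
    (D : Derivation R B B) (u v : B) : ⁅u • D, v • D⁆ = (u * D v - v * D u) • D := by
  ext f
  simp only [Derivation.commutator_apply, Derivation.smul_apply, smul_eq_mul, Derivation.leibniz]
  ring

/-- An algebra homomorphism `Ψ` with `d Ψ(u) = Ψ(∂u) t` for an invertible `t` induces the
homomorphism `u ∂ ↦ t⁻¹ Ψ(u) d` of Lie algebras of derivations. -/
def Zassenhaus.toDerivation {K : Type*} [Field K] {p : ℕ} [CharP K p] [Fact p.Prime] {n : ℕ}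
    (hn : 1 ≤ n) {B : Type*} [CommRing B] [Algebra K B] (d : Derivation K B B)
    (Ψ : DivPow K p n →ₐ[K] B) (τ t : B) (hτ : τ * t = 1)
    (hΨ : ∀ u, d (Ψ u) = Ψ (DivPow.del K p n u) * t) :
    Zassenhaus K p n →ₗ⁅K⁆ Derivation K B B where
  toFun X := (τ * Ψ (equivDivPow K p hn X)) • d
  map_add' X Y := by rw [map_add, map_add, mul_add, add_smul]
  map_smul' c X := by
    rw [map_smul, map_smul, mul_smul_comm, smul_assoc, RingHom.id_apply]
  map_lie' {X Y} := by
    obtain ⟨u, rfl⟩ := (equivDivPow K p hn).symm.surjective X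
    obtain ⟨v, rfl⟩ := (equivDivPow K p hn).symm.surjective Y
    rw [equivDivPow_symm, equivDivPow_symm, ofCoeff_lie, equivDivPow_ofCoeff, equivDivPow_ofCoeff,
      equivDivPow_ofCoeff, Derivation.smul_lie_smul_self]
    congr 1
    simp only [Derivation.leibniz, hΨ, map_sub, map_mul, smul_eq_mul]
    linear_combination (τ * Ψ v * Ψ (DivPow.del K p n u) -
      τ * Ψ u * Ψ (DivPow.del K p n v)) * hτ

namespace DPSeries

variable {K : Type*} [Field K] (p : ℕ) [Fact p.Prime] [CharP K p]

/-- The equations for the coefficients of `x^(p^l)` in `s` can be solved successively over a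
perfect field: the equation number `j` determines a power of the last unknown occurring in it. -/
theorem exists_solution [PerfectRing K p] (n : ℕ) (γ : ℕ → K) (hγ : γ n = 1) :
    ∃ a : ℕ → K, a 0 = 1 ∧ ∀ j, j + 1 < n →
      ∑ i ∈ Finset.Ioc j n, γ i * a (i - 1 - j) ^ p ^ (j + 1) = 0 := by
  have key : ∀ M, ∃ a : ℕ → K, a 0 = 1 ∧ ∀ j, j + 1 < n → n - 1 - j ≤ M →
      ∑ i ∈ Finset.Ioc j n, γ i * a (i - 1 - j) ^ p ^ (j + 1) = 0 := by
    intro M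
    induction M with
    | zero => exact ⟨fun _ => 1, rfl, fun j hj hj' => by omega⟩
    | succ M ih =>
      obtain ⟨a, ha0, ha⟩ := ih
      by_cases hM : n < M + 2
      · exact ⟨a, ha0, fun j hj hj' => ha j hj (by omega)⟩
      · obtain ⟨j₀, rfl⟩ := Nat.exists_eq_add_of_le' (not_lt.1 hM)
        obtain ⟨v, hv⟩ := (iterateFrobeniusEquiv K p (j₀ + 1)).surjective
          (-∑ i ∈ Finset.Ioc j₀ (j₀ + M + 1), γ i * a (i - 1 - j₀) ^ p ^ (j₀ + 1))
        rw [iterateFrobeniusEquiv_def] at hv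
        refine ⟨Function.update a (M + 1) v, by simp [ha0], fun j hj hj' => ?_⟩
        by_cases h : j = j₀
        · subst h
          rw [show j + (M + 2) = j + M + 1 + 1 by omega] at hγ ⊢
          rw [← Finset.insert_Ioc_right_eq_Ioc_add_one (by omega),
            Finset.sum_insert (by simp), hγ, one_mul,
            show j + M + 1 + 1 - 1 - j = M + 1 by omega, Function.update_self, hv,
            neg_add_eq_zero]
          refine Finset.sum_congr rfl fun i hi => ?_
          rw [Finset.mem_Ioc] at hi
          rw [Function.update_of_ne (by omega)]
        · rw [← ha j hj (by omega)]
          refine Finset.sum_congr rfl fun i hi => ?_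
          rw [Finset.mem_Ioc] at hi
          rw [Function.update_of_ne (by omega)]
  obtain ⟨a, ha0, ha⟩ := key n
  exact ⟨a, ha0, fun j hj => ha j hj (by omega)⟩

variable {p} in
theorem coeff_zero_lift_dpow {n : ℕ} (s : DPSeries K) (u : DivPow K p n) :
    (DivPow.lift (dpow s) (dpow_zero s) (dpow_mul_dpow s) u).coeff 0 = u.coeff 0 := by
  simp [DivPow.lift_apply, coeff_sum, coeff_zero_dpow, (Fact.out : p.Prime).pos]

variable {p} in
theorem del_lift_dpow {n : ℕ} (s : DPSeries K) (u : DivPow K p n) :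
    del (DivPow.lift (dpow s) (dpow_zero s) (dpow_mul_dpow s) u) =
      DivPow.lift (dpow s) (dpow_zero s) (dpow_mul_dpow s) (DivPow.del K p n u) * del s := by
  obtain ⟨N, hN⟩ := Nat.exists_eq_add_of_le' (pow_pos (Fact.out : p.Prime).pos n)
  simp only [DivPow.lift_apply, map_sum, hN, Derivation.map_smul, DivPow.coeff_del]
  rw [Finset.sum_range_succ', Finset.sum_range_succ, DivPow.coeff_of_le u hN.le, dpow_zero,
    Derivation.map_one_eq_zero, smul_zero, zero_smul, add_zero, add_zero, Finset.sum_mul]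
  exact Finset.sum_congr rfl fun k _ => by rw [del_dpow_succ, smul_mul_assoc]

/-- Over a perfect field, the Lie algebra of derivations `v ∂`, `v ∈ V`, for a finite-dimensional
differential algebra `V ≠ K` of divided power series is a Zassenhaus algebra `W_1(n)`, where
`p^n = dim V`. If `s ∈ V` is chosen such that `∂s` is invertible and all the divided powers `s^(k)`,
`k < p^n`, belong to `V`, then `x^(k) ↦ s^(k)` identifies `O_1(n)` with `V` and `∂` with
`(∂s)⁻¹ ∂`. -/
theorem exists_zassenhaus_toDerivation [PerfectRing K p] (V : Subalgebra K (DPSeries K))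
    [FiniteDimensional K V] (hV : ∀ f ∈ V, del f ∈ V) (hV1 : ∃ f ∈ V, del f ≠ 0) :
    ∃ (n : ℕ) (_ : 1 ≤ n) (g : Zassenhaus K p n →ₗ⁅K⁆ Derivation K (DPSeries K) (DPSeries K)),
      Function.Injective g ∧ (g.range : Set (Derivation K (DPSeries K) (DPSeries K))) =
        {E | ∃ v ∈ V, E = v • del} := by
  have hp := (Fact.out : p.Prime)
  obtain ⟨n, γ, hγ, hfin, hmem, hex⟩ := exists_frobenius_equation V p hV
  have hn : 1 ≤ n := by
    by_contra h
    obtain rfl : n = 0 := by omega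
    obtain ⟨f, hf, hf'⟩ := hV1
    rw [hmem] at hf
    simp only [zero_add, Finset.sum_range_one, hγ, pow_zero, one_smul, Function.iterate_one] at hf
    exact hf' hf
  obtain ⟨a, ha0, ha⟩ := exists_solution p n γ hγ
  obtain ⟨s, hsV, hs⟩ := hex fun i => a (Nat.log p i)
  have hs' : ∀ l < n, s.coeff (p ^ l) = a l := fun l hl => by
    rw [hs _ (Nat.pow_lt_pow_right hp.one_lt hl), Nat.log_pow hp.one_lt]
  have hdpow : ∀ k < p ^ n, dpow s k ∈ V := fun k hk => by
    rw [hmem]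
    refine sum_smul_iterate_del_dpow_eq_zero p s n γ ((hmem s).1 hsV) (fun j hj => ?_) hk
    rw [← ha j hj]
    refine Finset.sum_congr rfl fun i hi => ?_
    rw [Finset.mem_Ioc] at hi
    rw [hs' _ (by omega)]
  -- `∂s` has constant term `1`, so that `(∂s)^p = 1`
  have hunit : del s ^ (p - 1) * del s = 1 := by
    rw [← pow_succ, Nat.sub_add_cancel hp.one_le, pow_char p, coeff_del, zero_add]
    have := hs' 0 hn
    rw [pow_zero] at this
    rw [this, ha0, one_pow, map_one]
  have hdelV := hV s hsV
  let Ψ : DivPow K p n →ₐ[K] DPSeries K := DivPow.lift (dpow s) (dpow_zero s) (dpow_mul_dpow s)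
  have hΨV : ∀ u, Ψ u ∈ V := fun u => by
    change ∑ i ∈ Finset.range (p ^ n), u.coeff i • dpow s i ∈ V
    exact V.sum_mem fun i hi => V.smul_mem (hdpow i (Finset.mem_range.1 hi)) _
  have hΨdel : ∀ u, del (Ψ u) = Ψ (DivPow.del K p n u) * del s := del_lift_dpow s
  -- if `Ψ u = 0`, then `Ψ (∂^k u) = 0` for all `k`, and its constant term is the coefficient `u_k`
  have hΨinj : Function.Injective Ψ := by
    rw [injective_iff_map_eq_zero]
    intro u hu
    have hit : ∀ k, Ψ ((DivPow.del K p n)^[k] u) = 0 := by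
      intro k
      induction k with
      | zero => exact hu
      | succ k ih =>
        have h1 := hΨdel ((DivPow.del K p n)^[k] u)
        rw [ih, map_zero] at h1
        rw [Function.iterate_succ_apply']
        linear_combination (-Ψ (DivPow.del K p n ((DivPow.del K p n)^[k] u))) * hunit -
          del s ^ (p - 1) * h1
    refine DivPow.ext fun k _ => ?_
    have h1 := coeff_zero_lift_dpow s ((DivPow.del K p n)^[k] u)
    change (Ψ _).coeff 0 = _ at h1
    rw [hit, DivPow.coeff_iterate_del, zero_add] at h1
    rw [DivPow.coeff_zero, ← h1, coeff_zero]
  have hΨsurj : ∀ v ∈ V, ∃ u, Ψ u = v := by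
    have h1 : LinearMap.range Ψ.toLinearMap = V.toSubmodule := by
      have : FiniteDimensional K V.toSubmodule := ‹FiniteDimensional K V›
      refine Submodule.eq_of_le_of_finrank_eq ?_ ?_
      · rintro _ ⟨u, rfl⟩
        exact hΨV u
      · rw [LinearMap.finrank_range_of_inj hΨinj]
        refine Eq.trans ?_ hfin.symm
        exact Module.finrank_fin_fun K
    intro v hv
    have : v ∈ LinearMap.range Ψ.toLinearMap := by rw [h1]; exact hv
    exact this
  let g := Zassenhaus.toDerivation hn del Ψ (del s ^ (p - 1)) (del s) hunit hΨdel
  have hg : ∀ X, g X = (del s ^ (p - 1) * Ψ (Zassenhaus.equivDivPow K p hn X)) • del :=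
    fun X => rfl
  refine ⟨n, hn, g, ?_, ?_⟩
  · rw [injective_iff_map_eq_zero]
    intro X hX
    rw [hg] at hX
    have h1 := congrArg (fun E : Derivation K (DPSeries K) (DPSeries K) => E s) hX
    simp only [Derivation.smul_apply, smul_eq_mul, Derivation.coe_zero, Pi.zero_apply] at h1
    have h2 : Ψ (Zassenhaus.equivDivPow K p hn X) = 0 := by
      linear_combination h1 - Ψ (Zassenhaus.equivDivPow K p hn X) * hunit
    have h3 := hΨinj (h2.trans (map_zero Ψ).symm)
    exact (LinearEquiv.map_eq_zero_iff _).1 h3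
  · ext E
    constructor
    · rintro ⟨X, rfl⟩
      exact ⟨_, V.mul_mem (V.pow_mem hdelV _) (hΨV _), hg X⟩
    · rintro ⟨v, hv, rfl⟩
      obtain ⟨u, hu⟩ := hΨsurj (v * del s) (V.mul_mem hv hdelV)
      refine ⟨Zassenhaus.ofCoeff K p n u, ?_⟩
      change g _ = _
      rw [hg, Zassenhaus.equivDivPow_ofCoeff, hu]
      congr 1
      linear_combination v * hunit

end DPSeries

/-! ### Simplicity of the Zassenhaus algebras -/

theorem LieAlgebra.IsSimple.of_equiv {K L L' : Type*} [Field K] [LieRing L] [LieAlgebra K L]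
    [LieRing L'] [LieAlgebra K L'] (e : L ≃ₗ⁅K⁆ L') (h : LieAlgebra.IsSimple K L') :
    LieAlgebra.IsSimple K L where
  eq_bot_or_eq_top I := by
    have key : ∀ x, x ∈ LieIdeal.comap e.symm.toLieHom I ↔ e.symm x ∈ I := fun x =>
      LieIdeal.mem_comap
    rcases h.eq_bot_or_eq_top (LieIdeal.comap e.symm.toLieHom I) with h | h
    · left
      rw [LieSubmodule.eq_bot_iff] at h ⊢
      intro x hx
      have := h (e x) ((key _).2 (by rwa [e.symm_apply_apply]))
      exact e.injective (this.trans (map_zero e.toLieHom).symm)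
    · right
      rw [eq_top_iff]
      intro x _
      have : e x ∈ LieIdeal.comap e.symm.toLieHom I := by rw [h]; trivial
      rwa [key, e.symm_apply_apply] at this
  non_abelian hab := h.non_abelian (e.symm.injective.isLieAbelian (f := e.symm.toLieHom) hab)

namespace Zassenhaus

open DivPow

variable {K : Type*} [Field K] {p : ℕ} [CharP K p] [Fact p.Prime] {n : ℕ}

theorem del_x_succ {i : ℕ} (hi : i + 1 < p ^ n) : del K p n (x (i + 1)) = x i := by
  refine DivPow.ext fun k hk => ?_
  rw [coeff_del, coeff_x, coeff_x]
  congr 1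
  apply propext
  omega

/-- An ideal of `W_1(n)` that contains `∂` is everything: it contains all `(∂ v) ∂ = [∂, v ∂]`,
and `[x^(1) ∂, x^(N - 1) ∂] = -2 x^(N - 1) ∂` for `N = p^n`. -/
theorem eq_top_of_ofCoeff_one_mem (hp : 2 < p) (hn : 1 ≤ n) (I : LieIdeal K (Zassenhaus K p n))
    (h : ofCoeff K p n 1 ∈ I) : I = ⊤ := by
  have hN : 2 < p ^ n := hp.trans_le (Nat.le_self_pow (by omega) p)
  have hdel : ∀ v, ofCoeff K p n (del K p n v) ∈ I := by
    intro v
    have := lie_mem_left K (Zassenhaus K p n) I _ (ofCoeff K p n v) h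
    rwa [ofCoeff_lie, Derivation.map_one_eq_zero, mul_zero, sub_zero, one_mul] at this
  have hx : ∀ i, i + 1 < p ^ n → ofCoeff K p n (x i) ∈ I := fun i hi => by
    rw [← del_x_succ hi]; exact hdel _
  obtain ⟨m, hm⟩ := Nat.exists_eq_add_of_le' hN.le
  have htop : ofCoeff K p n (x (m + 1)) ∈ I := by
    have h1 := lie_mem_left K (Zassenhaus K p n) I _ (ofCoeff K p n (x (m + 1))) (hx 1 hN)
    have h2 : (x 1 * del K p n (x (m + 1)) - x (m + 1) * del K p n (x 1) : DivPow K p n) =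
        (-2 : K) • x (m + 1) := by
      have h3 : ((m + 1 : ℕ) : K) = -1 := by
        have : ((m + 2 : ℕ) : K) = 0 := by
          rw [← hm, CharP.cast_eq_zero_iff K p]
          exact dvd_pow_self p (by omega)
        push_cast at this ⊢
        linear_combination this
      rw [del_x_one hn, mul_one, del_x_succ (by omega), x_mul_x 1 m (by omega) (by omega),
        add_comm 1 m, show (m + 1).choose m = m + 1 by simp, h3]
      module
    rw [ofCoeff_lie, h2] at h1
    have h4 : (2 : K) ≠ 0 := by
      have := (CharP.cast_eq_zero_iff K p 2).not.2 (Nat.not_dvd_of_pos_of_lt two_pos hp)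
      exact_mod_cast this
    have h5 := I.smul_mem (-2 : K)⁻¹ h1
    rw [← equivDivPow_symm hn, ← map_smul, smul_smul, inv_mul_cancel₀ (neg_ne_zero.2 h4),
      one_smul, equivDivPow_symm] at h5
    exact h5
  rw [eq_top_iff]
  intro δ _
  obtain ⟨u, rfl⟩ := (equivDivPow K p hn).symm.surjective δ
  rw [eq_sum_x u, map_sum]
  refine sum_mem fun i hi => ?_
  rw [map_smul]
  refine I.smul_mem _ ?_
  rw [Finset.mem_range] at hi
  by_cases h : i + 1 < p ^ n
  · exact hx i h
  · obtain rfl : i = m + 1 := by omega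
    exact htop

/-- The Zassenhaus algebras `W_1(n)`, `1 ≤ n`, are simple in characteristic `p ≠ 2`. -/
theorem isSimple (hp : 2 < p) (hn : 1 ≤ n) : LieAlgebra.IsSimple K (Zassenhaus K p n) where
  eq_bot_or_eq_top I := by
    rw [or_iff_not_imp_left]
    intro hI
    refine eq_top_of_ofCoeff_one_mem hp hn I ?_
    obtain ⟨δ, hδ, hδ0⟩ : ∃ δ ∈ I, δ ≠ 0 := by
      by_contra! h
      exact hI ((LieSubmodule.eq_bot_iff I).2 h)
    obtain ⟨u, rfl⟩ := (equivDivPow K p hn).symm.surjective δ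
    rw [equivDivPow_symm] at hδ
    have hu : u ≠ 0 := fun h => hδ0 (by rw [h, map_zero])
    have hit : ∀ k, ofCoeff K p n ((del K p n)^[k] u) ∈ I := by
      intro k
      induction k with
      | zero => exact hδ
      | succ k ih =>
        have := lie_mem_right K (Zassenhaus K p n) I (ofCoeff K p n 1) _ ih
        rwa [ofCoeff_lie, Derivation.map_one_eq_zero, mul_zero, sub_zero, one_mul,
          ← Function.iterate_succ_apply' (del K p n)] at this
    -- the last nonzero derivative of `u` is a constant
    have hex : ∃ k, (del K p n)^[k] u = 0 :=
      ⟨p ^ n, DivPow.ext fun i _ => by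
        rw [DivPow.coeff_iterate_del, coeff_of_le u (by omega), coeff_zero]⟩
    obtain ⟨k, hk, hk'⟩ : ∃ k, (del K p n)^[k] u ≠ 0 ∧ (del K p n)^[k + 1] u = 0 := by
      classical
      have h0 : Nat.find hex ≠ 0 := fun h => hu (by simpa [h] using Nat.find_spec hex)
      obtain ⟨k, hk⟩ := Nat.exists_eq_succ_of_ne_zero h0
      exact ⟨k, Nat.find_min hex (by omega), by
        rw [← Nat.succ_eq_add_one, ← hk]; exact Nat.find_spec hex⟩
    set w := (del K p n)^[k] u with hw
    have hconst : w = w.coeff 0 • (1 : DivPow K p n) := by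
      refine DivPow.ext fun i hi => ?_
      rw [show (1 : DivPow K p n) = x 0 from rfl, coeff_smul, coeff_x]
      cases i with
      | zero => simp [hi]
      | succ i =>
        rw [Function.iterate_succ_apply', ← hw] at hk'
        rw [← coeff_del, hk']
        simp
    have hc : w.coeff 0 ≠ 0 := fun h => hk (by rw [hconst, h, zero_smul])
    have h1 := I.smul_mem (w.coeff 0)⁻¹ (hit k)
    have h2 : (w.coeff 0)⁻¹ • w = 1 := by
      conv_lhs => rw [hconst]
      rw [coeff_smul, smul_smul, show (1 : DivPow K p n).coeff 0 = 1 by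
        rw [show (1 : DivPow K p n) = x 0 from rfl]
        simp [coeff_x, (Fact.out : p.Prime).pos], mul_one, inv_mul_cancel₀ hc, one_smul]
    rw [← equivDivPow_symm hn, ← map_smul, h2, equivDivPow_symm] at h1
    exact h1
  non_abelian h := by
    have hN : 2 < p ^ n := hp.trans_le (Nat.le_self_pow (by omega) p)
    have h1 := h.trivial (ofCoeff K p n 1) (ofCoeff K p n (x 1))
    rw [ofCoeff_lie, Derivation.map_one_eq_zero, mul_zero, sub_zero, one_mul, del_x_one hn] at h1
    have h2 := congrArg (equivDivPow K p hn) h1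
    rw [equivDivPow_ofCoeff, map_zero] at h2
    have h3 := congrArg (fun f => f.coeff 0) h2
    rw [show (1 : DivPow K p n) = x 0 from rfl] at h3
    simp [coeff_x, (Fact.out : p.Prime).pos] at h3

end Zassenhaus

/-! ### The algebra `𝔏(A, D)` as a Lie algebra of derivations of divided power series -/

namespace DPSeries

section Stretch

variable {K : Type*} [Field K] (p : ℕ) [Fact p.Prime] [CharP K p]

/-- The algebra homomorphism `x^(k) ↦ x^(p k)`. It is multiplicative by Lucas' theorem. -/
def stretch : DPSeries K →ₐ[K] DPSeries K :=
  AlgHom.ofLinearMap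
    { toFun f := ⟨fun k => if p ∣ k then f.coeff (k / p) else 0⟩
      map_add' f g := DPSeries.ext fun k => by
        simp only [coeff_add]
        split_ifs <;> simp
      map_smul' c f := DPSeries.ext fun k => by
        simp only [coeff_smul, RingHom.id_apply]
        split_ifs <;> simp }
    (DPSeries.ext fun k => by
      have hp := (Fact.out : p.Prime).pos
      simp only [LinearMap.coe_mk, AddHom.coe_mk, coeff_one]
      by_cases hk : p ∣ k
      · obtain ⟨q, rfl⟩ := hk
        simp [hp.ne']
      · have : k ≠ 0 := by rintro rfl; exact hk (dvd_zero p)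
        simp [hk, this])
    (fun f g => DPSeries.ext fun k => by
      have hp := (Fact.out : p.Prime).pos
      simp only [LinearMap.coe_mk, AddHom.coe_mk, coeff_mul]
      by_cases hk : p ∣ k
      · obtain ⟨q, rfl⟩ := hk
        rw [if_pos (dvd_mul_right p q), Nat.mul_div_cancel_left q hp]
        have hinj : ∀ a ∈ Finset.HasAntidiagonal.antidiagonal q,
            ∀ b ∈ Finset.HasAntidiagonal.antidiagonal q,
            ((p * a.1, p * a.2) : ℕ × ℕ) = (p * b.1, p * b.2) → a = b := by
          rintro ⟨a, b⟩ _ ⟨c, d⟩ _ h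
          simpa [hp.ne'] using h
        symm
        rw [← Finset.sum_subset (s₁ := (Finset.HasAntidiagonal.antidiagonal q).image
          fun ij => (p * ij.1, p * ij.2)), Finset.sum_image hinj]
        · refine Finset.sum_congr rfl fun ij _ => ?_
          simp only [dvd_mul_right, if_true, Nat.mul_div_cancel_left _ hp]
          congr 1
          exact (CharP.natCast_eq_natCast K p).2 Choose.choose_mul_mul_modEq_choose_nat
        · intro ij hij
          obtain ⟨⟨a, b⟩, hab, rfl⟩ := Finset.mem_image.1 hij
          rw [Finset.HasAntidiagonal.mem_antidiagonal] at hab ⊢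
          rw [← hab, mul_add]
        · rintro ⟨i, j⟩ hij hne
          rw [Finset.HasAntidiagonal.mem_antidiagonal] at hij
          simp only at hij
          by_cases hi : p ∣ i
          · have hj : p ∣ j := (Nat.dvd_add_right hi).1 (hij ▸ dvd_mul_right p q)
            obtain ⟨a, rfl⟩ := hi
            obtain ⟨b, rfl⟩ := hj
            refine absurd (Finset.mem_image.2 ⟨(a, b), ?_, rfl⟩) hne
            rw [Finset.HasAntidiagonal.mem_antidiagonal]
            rw [← mul_add] at hij
            exact Nat.eq_of_mul_eq_mul_left hp hij
          · simp [hi]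
      · rw [if_neg hk]
        symm
        refine Finset.sum_eq_zero ?_
        rintro ⟨i, j⟩ hij
        rw [Finset.HasAntidiagonal.mem_antidiagonal] at hij
        simp only at hij
        by_cases hi : p ∣ i
        · have hj : ¬p ∣ j := fun hj => hk (hij ▸ dvd_add hi hj)
          simp [hj]
        · simp [hi])

theorem coeff_stretch (f : DPSeries K) (k : ℕ) :
    (stretch p f).coeff k = if p ∣ k then f.coeff (k / p) else 0 := rfl

/-- The series `x^(1)`. -/
def X : DPSeries K := ⟨fun k => if k = 1 then 1 else 0⟩

theorem del_X : del (X : DPSeries K) = 1 :=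
  DPSeries.ext fun k => by
    rw [coeff_del, coeff_one]
    simp [X]

theorem coeff_dpow_X (i k : ℕ) : (dpow (X : DPSeries K) i).coeff k = if k = i then 1 else 0 := by
  induction i generalizing k with
  | zero => rw [dpow_zero, coeff_one]
  | succ i ih =>
    cases k with
    | zero => simp [coeff_zero_dpow]
    | succ k => rw [← coeff_del, del_dpow_succ, del_X, mul_one, ih]; simp

theorem del_stretch (f : DPSeries K) :
    del (stretch p f) = dpow X (p - 1) * stretch p (del f) := by
  have hp := (Fact.out : p.Prime)
  refine DPSeries.ext fun k => ?_
  rw [coeff_del, coeff_stretch, coeff_mul]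
  by_cases hk : p ∣ k + 1
  · obtain ⟨q, hq⟩ := hk
    obtain ⟨q, rfl⟩ : ∃ q', q = q' + 1 := Nat.exists_eq_succ_of_ne_zero (by
      rintro rfl; simp at hq)
    have hk : k = p - 1 + p * q := by
      have := hp.one_le
      rw [mul_add, mul_one] at hq
      omega
    rw [hq, if_pos (dvd_mul_right _ _), Nat.mul_div_cancel_left _ hp.pos,
      Finset.sum_eq_single (p - 1, p * q)]
    · have h1 : k.choose (p - 1) ≡ 1 [MOD p] := by
        refine Choose.choose_modEq_choose_mod_mul_choose_div_nat.trans ?_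
        have h2 : p - 1 < p := Nat.sub_lt hp.pos one_pos
        rw [hk, Nat.add_mul_mod_self_left, Nat.mod_eq_of_lt h2, Nat.choose_self,
          Nat.div_eq_of_lt h2, Nat.choose_zero_right]
      rw [(CharP.natCast_eq_natCast K p).2 h1, coeff_dpow_X, coeff_stretch]
      simp [Nat.mul_div_cancel_left _ hp.pos]
    · rintro ⟨i, j⟩ hij hne
      rw [Finset.HasAntidiagonal.mem_antidiagonal] at hij
      have : i ≠ p - 1 := by
        rintro rfl
        apply hne
        simp only [Prod.mk.injEq, true_and]
        simp only at hij
        omega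
      simp [coeff_dpow_X, this]
    · intro h
      exact absurd (Finset.HasAntidiagonal.mem_antidiagonal.2 hk.symm) h
  · rw [if_neg hk, Finset.sum_eq_zero]
    rintro ⟨i, j⟩ hij
    rw [Finset.HasAntidiagonal.mem_antidiagonal] at hij
    simp only at hij
    rw [coeff_dpow_X, coeff_stretch]
    by_cases hi : i = p - 1
    · have : ¬p ∣ j := by
        rintro ⟨q, rfl⟩
        refine hk ⟨q + 1, ?_⟩
        have := hp.one_le
        rw [mul_add, mul_one]
        omega
      simp [this]
    · simp [hi]

end Stretch

end DPSeries

namespace KuznetsovAlgebra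

open DPSeries

variable {K A : Type*} [Field K] {p : ℕ} [CharP K p] [Fact p.Prime] [CommRing A] [Algebra K A]
  (D : Derivation K A A) (ε : A →ₐ[K] K)

variable (K p) in
/-- The embedding of `O_1(1)` into the ring of divided power series. -/
noncomputable def divPowToSeries : DivPow K p 1 →ₐ[K] DPSeries K :=
  DivPow.lift (dpow X) (dpow_zero X) (dpow_mul_dpow X)

theorem del_divPowToSeries (u : DivPow K p 1) :
    del (divPowToSeries K p u) = divPowToSeries K p (DivPow.del K p 1 u) := by
  rw [divPowToSeries, del_lift_dpow, del_X, mul_one]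

variable (p) in
/-- The homomorphism `a ↦ ∑ ε(D^k a) x^(p k)`. -/
noncomputable def stretchedTaylor : A →ₐ[K] DPSeries K := (stretch p).comp (taylor D ε)

theorem del_stretchedTaylor (a : A) : del (stretchedTaylor p D ε a) =
    divPowToSeries K p (DivPow.x (p - 1)) * stretchedTaylor p D ε (D a) := by
  have hp := (Fact.out : p.Prime).pos
  have h : divPowToSeries K p (DivPow.x (p - 1)) = dpow X (p - 1) := by
    rw [divPowToSeries, DivPow.lift_apply, Finset.sum_eq_single (p - 1)]
    · rw [DivPow.coeff_x, if_pos ⟨rfl, by rw [pow_one]; omega⟩, one_smul]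
    · intro i _ hi
      rw [DivPow.coeff_x, if_neg (fun h => hi h.1), zero_smul]
    · intro h
      refine absurd (Finset.mem_range.2 ?_) h
      rw [pow_one]; omega
  rw [h, stretchedTaylor, AlgHom.comp_apply, del_stretch, del_taylor, AlgHom.comp_apply]

variable (p) in
/-- The homomorphism `A ⊗ O_1(1) → DPSeries K`, which is the Taylor expansion along the derivation
`∂ + x^(p-1) D` of `A ⊗ O_1(1)`. -/
noncomputable def toSeries : A ⊗[K] DivPow K p 1 →ₐ[K] DPSeries K :=
  Algebra.TensorProduct.productMap (stretchedTaylor p D ε) (divPowToSeries K p)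

theorem toSeries_tmul (a : A) (u : DivPow K p 1) :
    toSeries p D ε (a ⊗ₜ u) = stretchedTaylor p D ε a * divPowToSeries K p u :=
  Algebra.TensorProduct.productMap_apply_tmul _ _ _ _

theorem del_mem_range_toSeries {f : DPSeries K} (hf : f ∈ (toSeries p D ε).range) :
    del f ∈ (toSeries p D ε).range := by
  obtain ⟨X, rfl⟩ := hf
  change del (toSeries p D ε X) ∈ _
  induction X using TensorProduct.induction_on with
  | zero => rw [map_zero, map_zero]; exact Subalgebra.zero_mem _
  | add X Y hX hY => rw [map_add, map_add]; exact Subalgebra.add_mem _ hX hY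
  | tmul a u =>
    refine ⟨a ⊗ₜ DivPow.del K p 1 u + D a ⊗ₜ (DivPow.x (p - 1) * u), ?_⟩
    change toSeries p D ε _ = _
    rw [map_add, toSeries_tmul, toSeries_tmul, toSeries_tmul, Derivation.leibniz,
      del_stretchedTaylor, del_divPowToSeries, map_mul]
    simp only [smul_eq_mul]
    ring

variable (p) in
/-- The map `∑ a_i ⊗ u_i ∂ ↦ T(∑ a_i ⊗ u_i)`, where `T` is the homomorphism `toSeries`. -/
noncomputable def seriesOf : A ⊗[K] Zassenhaus K p 1 →ₗ[K] DPSeries K :=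
  (toSeries p D ε).toLinearMap ∘ₗ
    (TensorProduct.congr (LinearEquiv.refl K A) (Zassenhaus.equivDivPow K p le_rfl)).toLinearMap

theorem seriesOf_tmul (a : A) (u : DivPow K p 1) :
    seriesOf p D ε (a ⊗ₜ Zassenhaus.ofCoeff K p 1 u) =
      stretchedTaylor p D ε a * divPowToSeries K p u := by
  rw [seriesOf, LinearMap.comp_apply, LinearEquiv.coe_coe, TensorProduct.congr_tmul,
    Zassenhaus.equivDivPow_ofCoeff]
  exact toSeries_tmul D ε a u

theorem range_seriesOf :
    LinearMap.range (seriesOf p D ε) = (toSeries p D ε).range.toSubmodule := by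
  rw [seriesOf, LinearMap.range_comp, LinearEquiv.range, Submodule.map_top]
  rfl

theorem seriesOf_br (X Y : A ⊗[K] Zassenhaus K p 1) :
    seriesOf p D ε (br D X Y) = seriesOf p D ε X * del (seriesOf p D ε Y) -
      seriesOf p D ε Y * del (seriesOf p D ε X) := by
  induction X using tmul_induction with
  | zero => simp [br, Phi]
  | add X X' h h' => rw [add_br, map_add, map_add, map_add, h, h']; ring
  | tmul a u =>
    induction Y using tmul_induction with
    | zero => simp [br, Phi]
    | add X X' h h' => rw [br_add, map_add, map_add, map_add, h, h']; ring
    | tmul b v =>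
      have htop : divPowToSeries K p u * divPowToSeries K p v *
          divPowToSeries K p (DivPow.x (p - 1)) =
          algebraMap K _ (u.coeff 0 * v.coeff 0) * divPowToSeries K p (DivPow.x (p - 1)) := by
        rw [← map_mul, ← map_mul, mul_x_top, coeff_zero_mul, map_smul, Algebra.smul_def]
      rw [br, LieAlgebra.ExtendScalars.bracket_tmul, ofCoeff_lie, Phi, coeffNegOne_tmul,
        coeffNegOne_tmul, Derivation.map_smul, Derivation.map_smul, map_add, seriesOf_tmul,
        seriesOf_tmul, seriesOf_tmul, seriesOf_tmul,
        Derivation.leibniz, Derivation.leibniz, del_stretchedTaylor, del_stretchedTaylor,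
        del_divPowToSeries, del_divPowToSeries]
      simp only [map_sub, map_mul, smul_eq_mul, Algebra.smul_def,
        AlgHom.commutes] at htop ⊢
      linear_combination (stretchedTaylor p D ε b * stretchedTaylor p D ε (D a) -
        stretchedTaylor p D ε a * stretchedTaylor p D ε (D b)) * htop

/-- The homomorphism of `𝔏(A, D)` to the Lie algebra of derivations of the ring of divided power
series. -/
noncomputable def toDerivation :
    KuznetsovAlgebra p D →ₗ⁅K⁆ Derivation K (DPSeries K) (DPSeries K) where
  toFun X := (seriesOf p D ε X) • del
  map_add' X Y := by
    rw [← add_smul]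
    exact congrArg (· • del) (map_add (seriesOf p D ε) X Y)
  map_smul' c X := by
    rw [RingHom.id_apply, ← smul_assoc]
    exact congrArg (· • del) (map_smul (seriesOf p D ε) c X)
  map_lie' {X Y} := by
    rw [Derivation.smul_lie_smul_self]
    exact congrArg (· • del) (seriesOf_br D ε X Y)

theorem toDerivation_apply (X : KuznetsovAlgebra p D) :
    toDerivation D ε X = (seriesOf p D ε X) • del := rfl

theorem seriesOf_one : seriesOf p D ε (1 ⊗ₜ Zassenhaus.ofCoeff K p 1 1) = 1 := by
  rw [seriesOf_tmul, map_one, map_one, one_mul]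

theorem toDerivation_injective (h : LieAlgebra.IsSimple K (KuznetsovAlgebra p D)) :
    Function.Injective (toDerivation (p := p) D ε) := by
  rw [← LieHom.ker_eq_bot]
  refine (h.eq_bot_or_eq_top _).resolve_right fun htop => ?_
  let E : KuznetsovAlgebra p D := (1 ⊗ₜ Zassenhaus.ofCoeff K p 1 1 : A ⊗[K] Zassenhaus K p 1)
  have h1 : toDerivation D ε E = 0 := LieHom.mem_ker.1 (htop ▸ LieSubmodule.mem_top E)
  rw [toDerivation_apply, show seriesOf p D ε E = 1 from seriesOf_one D ε, one_smul] at h1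
  have h2 := congrArg (fun E : Derivation K (DPSeries K) (DPSeries K) => E X) h1
  simp only [del_X] at h2
  exact one_ne_zero (α := DPSeries K) h2

/-- If all residue fields of `A` are equal to `K` and `𝔏(A, D)` is simple, then it is isomorphic
to a Zassenhaus algebra. -/
theorem exists_equiv_zassenhaus [PerfectField K] [FiniteDimensional K A]
    (hres : ∀ M : Ideal A, M.IsMaximal → Function.Bijective (algebraMap K (A ⧸ M)))
    (h : LieAlgebra.IsSimple K (KuznetsovAlgebra p D)) :
    ∃ n : ℕ, 1 ≤ n ∧ Nonempty (KuznetsovAlgebra p D ≃ₗ⁅K⁆ Zassenhaus K p n) := by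
  have hp := (Fact.out : p.Prime)
  have : ExpChar K p := ExpChar.prime hp
  have : PerfectRing K p := PerfectField.toPerfectRing p
  have : Nontrivial A := by
    by_contra hA
    rw [not_nontrivial_iff_subsingleton] at hA
    have hsub : Subsingleton (KuznetsovAlgebra p D) :=
      (inferInstance : Subsingleton (A ⊗[K] Zassenhaus K p 1))
    exact h.non_abelian ⟨fun _ _ => Subsingleton.elim _ _⟩
  obtain ⟨M, hM⟩ := Ideal.exists_maximal A
  let ε : A →ₐ[K] K :=
    (AlgEquiv.ofBijective (Algebra.ofId K (A ⧸ M)) (hres M hM)).symm.toAlgHom.comp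
      (Ideal.Quotient.mkₐ K M)
  let V := (toSeries p D ε).range
  have : FiniteDimensional K (DivPow K p 1) :=
    inferInstanceAs (FiniteDimensional K (Fin (p ^ 1) → K))
  have hVfin : FiniteDimensional K V :=
    (inferInstance : FiniteDimensional K (LinearMap.range (toSeries p D ε).toLinearMap))
  have hV1 : ∃ f ∈ V, del f ≠ 0 := by
    refine ⟨_, ⟨1 ⊗ₜ DivPow.x 1, rfl⟩, ?_⟩
    change del (toSeries p D ε _) ≠ 0
    rw [toSeries_tmul, map_one, one_mul, del_divPowToSeries, del_x_one, map_one]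
    exact one_ne_zero (α := DPSeries K)
  obtain ⟨n, hn, g, hg, hgV⟩ := exists_zassenhaus_toDerivation p V
    (fun f hf => del_mem_range_toSeries D ε hf) hV1
  refine ⟨n, hn, ⟨(LieEquiv.ofInjective _ (toDerivation_injective D ε h)).trans
    ((LieEquiv.ofEq _ _ ?_).trans (LieEquiv.ofInjective g hg).symm)⟩⟩
  rw [hgV]
  ext E
  constructor
  · rintro ⟨X, rfl⟩
    refine ⟨seriesOf p D ε X, ?_, rfl⟩
    change _ ∈ (toSeries p D ε).range.toSubmodule
    rw [← range_seriesOf]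
    exact ⟨X, rfl⟩
  · rintro ⟨v, hv, rfl⟩
    change v ∈ (toSeries p D ε).range.toSubmodule at hv
    rw [← range_seriesOf] at hv
    obtain ⟨X, rfl⟩ := hv
    exact ⟨X, rfl⟩

end KuznetsovAlgebra

theorem lemma6p3 {K A : Type*} [Field K] [PerfectField K] (p : ℕ) [Fact p.Prime] [CharP K p]
    (hp : 3 < p) [CommRing A] [Algebra K A] [FiniteDimensional K A] (D : Derivation K A A) :
    ((∃ n : ℕ, 1 ≤ n ∧ Nonempty (KuznetsovAlgebra p D ≃ₗ⁅K⁆ Zassenhaus K p n)) →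
      LieAlgebra.IsSimple K (KuznetsovAlgebra p D)) ∧
    ((∀ M : Ideal A, M.IsMaximal → Function.Bijective (algebraMap K (A ⧸ M))) →
      LieAlgebra.IsSimple K (KuznetsovAlgebra p D) →
      ∃ n : ℕ, 1 ≤ n ∧ Nonempty (KuznetsovAlgebra p D ≃ₗ⁅K⁆ Zassenhaus K p n)) := by
  refine ⟨?_, KuznetsovAlgebra.exists_equiv_zassenhaus D⟩
  rintro ⟨n, hn, ⟨e⟩⟩
  exact .of_equiv e (Zassenhaus.isSimple (by omega) hn)
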